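/- Let $f=(f(0),f(1),f(2),\dots)$ be a sequence of complex numbers such that for every $l\in\mathbb N=\{0,1,2,\dots\}$ the autocovariance $$\rho_l=\lim_{n\to\infty}\frac1n\sum_{k=0}^{n} f(k)\,\overline{f(k+l)}$$ exists. Let $\tilde{\mathcal H}_f\subset\mathbb C^{\mathbb N}$ be the linear span of the shifted sequences $F_l=(f(l),f(l+1),\dots)$, $l\in\mathbb N$, with the (possibly degenerate) inner product $\langle h,g\rangle=\lim_{n\to\infty}\frac1n\sum_{k=0}^{n-1}h_k\overline{g_k}$ (the limit exists), let $\mathcal H_f$ be the Hilbert space obtained from it by completion (vectors of norm zero being identified with $0$), and let $\mathcal K$ be the isometry of $\mathcal H_f$ that extends the time shift $F_l\mapsto F_{l+1}$. Regard $f=F_0$ as an element of $\mathcal H_f$. Then $f$ has an expansion $$f=\sum_{i\ge1}a_iv_i+f^{\perp},\qquad |a_1|\ge|a_2|\ge\dots\ge0,$$ where the $v_i$ are unit eigenvectors of $\mathcal K$ with pairwise distinct eigenvalues and $f^\perp$ is orthogonal to all eigenvectors of $\mathcal K$; if only finitely many terms occur, we put $a_i=0$ for all further $i$. Moreover, for every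 such expansion the following holds. Let $\delta_{NM,1}\ge\delta_{NM,2}\ge\dots\ge0$ be the singular values, counted with multiplicity and continued by zeros, of the $(N+1)\times(M+1)$ trajectory matrix $$A_{NM}(f)=\bigl(f(i+j)\bigr)_{0\le i\le N,\;0\le j\le M}.$$ Then for every $i\ge1$ the inner limit below exists for every $N\ge1$, the outer limit exists, and $$\lim_{N\to\infty}\lim_{M\to\infty}\frac{\delta_{NM,i}^2}{NM}=|a_i|^2 .$$ -/

import Mathlib

noncomputable section

namespace TimeSeries

open Filter Topology ComplexConjugate

/-- All autocovariances `ρ_l = lim_n (1/n) ∑_{k=0}^{n} f(k) conj (f(k+l))`, `l = 0, 1, 2, …`,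
of the time series `f(0), f(1), …` exist. -/
def AutocovExists (f : ℕ → ℂ) : Prop :=
  ∀ l : ℕ, ∃ ρ : ℂ, Tendsto
    (fun n : ℕ => (1 / (n : ℂ)) * ∑ k ∈ Finset.range (n + 1), f k * conj (f (k + l)))
    atTop (𝓝 ρ)

/-- The time shift `(h₀, h₁, …) ↦ (h₁, h₂, …)` of time series. -/
def shift : (ℕ → ℂ) →ₗ[ℂ] (ℕ → ℂ) where
  toFun h k := h (k + 1)
  map_add' _ _ := rfl
  map_smul' _ _ := rfl

/-- The linear span of the shifted series `F_l = (f(l), f(l+1), …)`, `l = 0, 1, 2, …`. -/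
def krylov (f : ℕ → ℂ) : Submodule ℂ (ℕ → ℂ) :=
  Submodule.span ℂ (Set.range fun l : ℕ => fun k : ℕ => f (k + l))

/-- The time averages `(1/n) ∑_{k<n} conj (h k) * g k`. They are conjugate-linear in the first
argument, as is Mathlib's convention for inner products. -/
def timeAvg (h g : ℕ → ℂ) (n : ℕ) : ℂ :=
  (1 / (n : ℂ)) * ∑ k ∈ Finset.range n, conj (h k) * g k

/-- The limit of the time averages. -/
def meanInner (h g : ℕ → ℂ) : ℂ := limUnder atTop (timeAvg h g)

theorem tendsto_average_shift {u : ℕ → ℂ} {c : ℂ}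
    (h : Tendsto (fun n : ℕ => (1 / (n : ℂ)) * ∑ k ∈ Finset.range n, u k) atTop (𝓝 c)) :
    Tendsto (fun n : ℕ => (1 / (n : ℂ)) * ∑ k ∈ Finset.range n, u (k + 1)) atTop (𝓝 c) := by
  have h1 := h.comp (tendsto_add_atTop_nat 1)
  have h2 : Tendsto (fun n : ℕ => 1 + 1 / (n : ℂ)) atTop (𝓝 (1 + 0)) :=
    tendsto_const_nhds.add tendsto_one_div_atTop_nhds_zero_nat
  have h3 : Tendsto (fun n : ℕ => 1 / (n : ℂ) * u 0) atTop (𝓝 (0 * u 0)) :=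
    tendsto_one_div_atTop_nhds_zero_nat.mul_const _
  have h4 := (h2.mul h1).sub h3
  simp only [add_zero, one_mul, zero_mul, sub_zero] at h4
  refine h4.congr' ?_
  filter_upwards [eventually_ge_atTop 1] with n hn
  have hn0 : (n : ℂ) ≠ 0 := by exact_mod_cast (by omega : n ≠ 0)
  have hn1 : (n : ℂ) + 1 ≠ 0 := by exact_mod_cast (by omega : n + 1 ≠ 0)
  simp only [Function.comp_apply]
  rw [Finset.sum_range_succ']
  push_cast
  field_simp
  ring

theorem tendsto_average_of_succ {u : ℕ → ℂ} {c : ℂ}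
    (h : Tendsto (fun n : ℕ => (1 / (n : ℂ)) * ∑ k ∈ Finset.range (n + 1), u k) atTop (𝓝 c)) :
    Tendsto (fun n : ℕ => (1 / (n : ℂ)) * ∑ k ∈ Finset.range n, u k) atTop (𝓝 c) := by
  rw [← tendsto_add_atTop_iff_nat 1]
  have h2 : Tendsto (fun n : ℕ => 1 - 1 / ((n : ℂ) + 1)) atTop (𝓝 (1 - 0)) :=
    tendsto_const_nhds.sub tendsto_one_div_add_atTop_nhds_zero_nat
  have h4 := h2.mul h
  simp only [sub_zero, one_mul] at h4
  refine h4.congr' ?_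
  filter_upwards [eventually_ge_atTop 1] with n hn
  have hn0 : (n : ℂ) ≠ 0 := by exact_mod_cast (by omega : n ≠ 0)
  have hn1 : (n : ℂ) + 1 ≠ 0 := by exact_mod_cast (by omega : n + 1 ≠ 0)
  push_cast
  field_simp
  ring

theorem timeAvg_conj (h g : ℕ → ℂ) (n : ℕ) : conj (timeAvg h g n) = timeAvg g h n := by
  simp [timeAvg, mul_comm]

theorem tendsto_timeAvg_shift {h g : ℕ → ℂ} {c : ℂ} (H : Tendsto (timeAvg h g) atTop (𝓝 c)) :
    Tendsto (timeAvg (shift h) (shift g)) atTop (𝓝 c) :=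
  tendsto_average_shift (u := fun k => conj (h k) * g k) H

theorem exists_tendsto_generators {f : ℕ → ℂ} (hf : AutocovExists f) (l m : ℕ) :
    ∃ c, Tendsto (timeAvg (fun k => f (k + l)) (fun k => f (k + m))) atTop (𝓝 c) := by
  have base : ∀ d : ℕ, ∃ c, Tendsto (timeAvg (fun k => f (k + d)) f) atTop (𝓝 c) := by
    intro d
    obtain ⟨ρ, hρ⟩ := hf d
    refine ⟨ρ, (tendsto_average_of_succ hρ).congr fun n => ?_⟩
    simp [timeAvg, mul_comm]
  have step : ∀ e d : ℕ, ∃ c,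
      Tendsto (timeAvg (fun k => f (k + (d + e))) (fun k => f (k + e))) atTop (𝓝 c) := by
    intro e
    induction e with
    | zero => exact base
    | succ e ih =>
      intro d
      obtain ⟨c, hc⟩ := ih d
      refine ⟨c, (tendsto_timeAvg_shift hc).congr fun n => ?_⟩
      have e1 : shift (fun k => f (k + (d + e))) = fun k => f (k + (d + (e + 1))) := by
        funext k; exact congrArg f (by omega)
      have e2 : shift (fun k => f (k + e)) = fun k => f (k + (e + 1)) := by
        funext k; exact congrArg f (by omega)
      rw [e1, e2]
  rcases le_total m l with hml | hlm
  · obtain ⟨c, hc⟩ := step m (l - m)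
    rw [Nat.sub_add_cancel hml] at hc
    exact ⟨c, hc⟩
  · obtain ⟨c, hc⟩ := step l (m - l)
    rw [Nat.sub_add_cancel hlm] at hc
    refine ⟨conj c, ((Complex.continuous_conj.tendsto c).comp hc).congr fun n => ?_⟩
    exact timeAvg_conj _ _ n

theorem timeAvg_add_left (h₁ h₂ g : ℕ → ℂ) (n : ℕ) :
    timeAvg (h₁ + h₂) g n = timeAvg h₁ g n + timeAvg h₂ g n := by
  simp [timeAvg, add_mul, Finset.sum_add_distrib, mul_add]

theorem timeAvg_smul_left (a : ℂ) (h g : ℕ → ℂ) (n : ℕ) :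
    timeAvg (a • h) g n = conj a * timeAvg h g n := by
  simp only [timeAvg, Pi.smul_apply, smul_eq_mul, map_mul, mul_assoc, ← Finset.mul_sum]
  ring

theorem exists_tendsto_left {s : Set (ℕ → ℂ)} {g : ℕ → ℂ}
    (H : ∀ h ∈ s, ∃ c, Tendsto (timeAvg h g) atTop (𝓝 c)) {h : ℕ → ℂ}
    (hh : h ∈ Submodule.span ℂ s) : ∃ c, Tendsto (timeAvg h g) atTop (𝓝 c) := by
  induction hh using Submodule.span_induction with
  | mem x hx => exact H x hx
  | zero => exact ⟨0, tendsto_const_nhds.congr fun n => by simp [timeAvg]⟩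
  | add x y _ _ hx hy =>
    obtain ⟨c, hc⟩ := hx
    obtain ⟨d, hd⟩ := hy
    exact ⟨c + d, (hc.add hd).congr fun n => (timeAvg_add_left x y g n).symm⟩
  | smul a x _ hx =>
    obtain ⟨c, hc⟩ := hx
    exact ⟨conj a * c, (hc.const_mul _).congr fun n => (timeAvg_smul_left a x g n).symm⟩

theorem exists_tendsto_conj {h g : ℕ → ℂ} (H : ∃ c, Tendsto (timeAvg h g) atTop (𝓝 c)) :
    ∃ c, Tendsto (timeAvg g h) atTop (𝓝 c) := by
  obtain ⟨c, hc⟩ := H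
  exact ⟨conj c, ((Complex.continuous_conj.tendsto c).comp hc).congr fun n => timeAvg_conj h g n⟩

theorem tendsto_meanInner {f : ℕ → ℂ} (hf : AutocovExists f) {h g : ℕ → ℂ}
    (hh : h ∈ krylov f) (hg : g ∈ krylov f) :
    Tendsto (timeAvg h g) atTop (𝓝 (meanInner h g)) := by
  refine tendsto_nhds_limUnder (exists_tendsto_left ?_ hh)
  rintro _ ⟨l, rfl⟩
  refine exists_tendsto_conj (exists_tendsto_left ?_ hg)
  rintro _ ⟨m, rfl⟩
  exact exists_tendsto_generators hf m l

theorem shift_mem_krylov {f h : ℕ → ℂ} (hh : h ∈ krylov f) : shift h ∈ krylov f := by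
  induction hh using Submodule.span_induction with
  | mem x hx =>
    obtain ⟨l, rfl⟩ := hx
    refine Submodule.subset_span ⟨l + 1, ?_⟩
    funext k
    exact congrArg f (by omega)
  | zero => simp
  | add x y _ _ hx hy => simpa using (krylov f).add_mem hx hy
  | smul a x _ hx => simpa using (krylov f).smul_mem a hx

/-- The space of finite linear combinations of the shifted series, which carries the inner product
given by time averages (and not the topology of pointwise convergence). -/
def PreHilbert (f : ℕ → ℂ) (_hf : AutocovExists f) : Type := krylov f

section

variable (f : ℕ → ℂ) (hf : AutocovExists f)

instance : AddCommGroup (PreHilbert f hf) := inferInstanceAs (AddCommGroup (krylov f))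

instance : Module ℂ (PreHilbert f hf) := inferInstanceAs (Module ℂ (krylov f))

/-- The time series underlying an element of the space. -/
def PreHilbert.val {f : ℕ → ℂ} {hf : AutocovExists f} (h : PreHilbert f hf) : ℕ → ℂ :=
  Subtype.val (p := fun x => x ∈ krylov f) h

theorem PreHilbert.tendsto_inner {f : ℕ → ℂ} {hf : AutocovExists f} (h g : PreHilbert f hf) :
    Tendsto (timeAvg h.val g.val) atTop (𝓝 (meanInner h.val g.val)) :=
  tendsto_meanInner hf (Subtype.property (p := fun x => x ∈ krylov f) h)
    (Subtype.property (p := fun x => x ∈ krylov f) g)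

/-- The (semi-definite) inner product `lim_n (1/n) ∑_{k<n} conj (h k) * g k`. -/
instance PreHilbert.core : PreInnerProductSpace.Core ℂ (PreHilbert f hf) where
  inner h g := meanInner h.val g.val
  conj_inner_symm h g := by
    refine tendsto_nhds_unique
      ((Complex.continuous_conj.tendsto _).comp (PreHilbert.tendsto_inner g h)) ?_
    exact (PreHilbert.tendsto_inner h g).congr fun n => (timeAvg_conj _ _ n).symm
  re_inner_nonneg h := by
    refine ge_of_tendsto ((Complex.continuous_re.tendsto _).comp (PreHilbert.tendsto_inner h h))
      (Eventually.of_forall fun n => ?_)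
    have e : timeAvg h.val h.val n
        = (((1 / (n : ℝ)) * ∑ k ∈ Finset.range n, Complex.normSq (h.val k) : ℝ) : ℂ) := by
      simp [timeAvg, Complex.normSq_eq_conj_mul_self]
    simp only [Function.comp_apply]
    rw [e, Complex.ofReal_re]
    exact mul_nonneg (by positivity) (Finset.sum_nonneg fun k _ => Complex.normSq_nonneg _)
  add_left h₁ h₂ g := by
    refine tendsto_nhds_unique (PreHilbert.tendsto_inner (h₁ + h₂) g) ?_
    exact ((PreHilbert.tendsto_inner h₁ g).add (PreHilbert.tendsto_inner h₂ g)).congr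
      fun n => (timeAvg_add_left _ _ _ n).symm
  smul_left h g a := by
    refine tendsto_nhds_unique (PreHilbert.tendsto_inner (a • h) g) ?_
    exact ((PreHilbert.tendsto_inner h g).const_mul (conj a)).congr
      fun n => (timeAvg_smul_left _ _ _ n).symm

instance : SeminormedAddCommGroup (PreHilbert f hf) :=
  InnerProductSpace.Core.toSeminormedAddCommGroup (𝕜 := ℂ)

instance : InnerProductSpace ℂ (PreHilbert f hf) :=
  InnerProductSpace.ofCore (PreHilbert.core f hf)

/-- The time shift on finite linear combinations of shifted series; it preserves norms. -/
def preKoopman : PreHilbert f hf →ₗᵢ[ℂ] PreHilbert f hf where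
  toFun h := ⟨shift h.val, shift_mem_krylov (Subtype.property (p := fun x => x ∈ krylov f) h)⟩
  map_add' _ _ := rfl
  map_smul' _ _ := rfl
  norm_map' h := by
    have e : meanInner (shift h.val) (shift h.val) = meanInner h.val h.val :=
      (tendsto_timeAvg_shift (PreHilbert.tendsto_inner h h)).limUnder_eq
    exact congrArg (fun z : ℂ => Real.sqrt z.re) e

/-- The Hilbert space `𝓗_f` of the time series: the (Hausdorff) completion. -/
abbrev HilbertSpace : Type := UniformSpace.Completion (PreHilbert f hf)

/-- The Koopman-like time-shift operator `𝓚` on `𝓗_f`. -/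
def koopman : HilbertSpace f hf →L[ℂ] HilbertSpace f hf :=
  (preKoopman f hf).toContinuousLinearMap.completion

/-- The time series `f` as an element of `𝓗_f`. -/
def observable : HilbertSpace f hf :=
  ((show PreHilbert f hf from ⟨f, Submodule.subset_span ⟨0, rfl⟩⟩ : PreHilbert f hf) :
    UniformSpace.Completion (PreHilbert f hf))

/-- `f = ∑ᵢ aᵢ vᵢ + r` is the expansion of `f` in eigenvectors of the time-shift operator:
the `vᵢ` are unit eigenvectors with pairwise distinct eigenvalues `ξᵢ`, `r` is orthogonal to all
eigenvectors, and `|a₀| ≥ |a₁| ≥ …`. If there are only finitely many eigenvectors up to scalars,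
the sequence `a` is continued by zeros; there is no condition on `vᵢ` and `ξᵢ` when `aᵢ = 0`. -/
structure IsEigenExpansion (a ξ : ℕ → ℂ) (v : ℕ → HilbertSpace f hf) (r : HilbertSpace f hf) :
    Prop where
  norm_eq_one : ∀ i, a i ≠ 0 → ‖v i‖ = 1
  eigen : ∀ i, a i ≠ 0 → koopman f hf (v i) = ξ i • v i
  distinct : ∀ i j, a i ≠ 0 → a j ≠ 0 → i ≠ j → ξ i ≠ ξ j
  remainder_orthogonal : ∀ (z : ℂ) (w : HilbertSpace f hf),
    koopman f hf w = z • w → inner ℂ w r = 0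
  hasSum : HasSum (fun i => a i • v i) (observable f hf - r)
  antitone : Antitone fun i => ‖a i‖

end

/-- The trajectory matrix `A_{NM}(f)`, of size `(N+1) × (M+1)`, with entries `f(i+j)`. -/
def trajectoryMatrix (f : ℕ → ℂ) (N M : ℕ) : Matrix (Fin (N + 1)) (Fin (M + 1)) ℂ :=
  Matrix.of fun i j => f ((i : ℕ) + (j : ℕ))

/-- The singular values `δ_{NM,0} ≥ δ_{NM,1} ≥ … ≥ 0` of the trajectory matrix, counted with
multiplicity, indexed from zero, and continued by zeros. -/
def trajectorySingularValue (f : ℕ → ℂ) (N M i : ℕ) : ℝ :=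
  (Matrix.toEuclideanLin (trajectoryMatrix f N M)).singularValues i

end TimeSeries

end

/-! For fixed `N`, the squared singular values are the leading eigenvalues of `A Aᴴ`, which acts on
`ℂ^(N+1)` whatever `M` is. The entries of `A Aᴴ / M` tend to autocovariances, so up to a complex
conjugation its quadratic form tends to `‖∑ xₖ 𝓚ᵏ f‖²`, uniformly on the unit ball. By
Courant–Fischer (`sq_singularValues_eq_maxMin_adjoint`, `tendsto_maxMin`) the eigenvalues converge
as well; this is the inner limit, `tendsto_sq_trajectorySingularValue`.

What remains is the growth in `n = N + 1` of the `i`-th eigenvalue of `x ↦ ‖∑ xₖ 𝓚ᵏ f‖²` on `ℂⁿ`.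
Finitely many terms of the expansion contribute `∑ |aⱼ|² |⟨χⱼ, x⟩|²`, where the characters `χⱼ` have
norm `√n` and are asymptotically orthogonal (`exists_tendsto_charVec_gram`); the eigenvalues of this
part are close to `n |aⱼ|²`. A tail `g` of the expansion adds at most `n ‖g‖²`. The remainder `r`
adds only `o(n)`: it is weakly mixing (`tendsto_average_sq_norm_inner_iterate`), so the Gram matrix
of `r, …, 𝓚ⁿ⁻¹ r` has Hilbert–Schmidt norm `o(n)` (`norm_orbitMap_sq_le_sqrt`).

Weak mixing is proved without spectral measures. An ultrafilter limit `S` of the averages of the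
rank-one forms of `𝓚ᵏ r` is positive of trace at most `‖r‖²`, hence compact, and commutes with `𝓚`.
If `S ≠ 0`, some eigenspace for a nonzero eigenvalue is finite-dimensional and `𝓚`-invariant, so it
contains an eigenvector of `𝓚`; as this is orthogonal to `r`, the form of `S` vanishes on it, a
contradiction. -/

open Filter Topology ComplexConjugate Module

/-! ### Courant–Fischer values of quadratic forms and singular values. -/

section MinMax

variable {E : Type*} [NormedAddCommGroup E] [InnerProductSpace ℂ E]

/-- The largest `c` such that `c * ‖x‖ ^ 2 ≤ q x` on some subspace of dimension `i + 1`. If `q` is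
a Hermitian form, this is its `i`-th largest eigenvalue, by the Courant–Fischer principle. -/
noncomputable def maxMin (q : E → ℝ) (i : ℕ) : ℝ :=
  sSup {c : ℝ | ∃ V : Submodule ℂ E, finrank ℂ V = i + 1 ∧ ∀ x ∈ V, c * ‖x‖ ^ 2 ≤ q x}

theorem exists_mem_ne_zero_of_finrank_succ {V : Submodule ℂ E} {i : ℕ}
    (hV : finrank ℂ V = i + 1) : ∃ x ∈ V, x ≠ 0 := by
  refine V.exists_mem_ne_zero_of_ne_bot ?_
  rintro rfl
  simp at hV

theorem le_of_forall_mem_bound {q : E → ℝ} {C c : ℝ} (hq : ∀ x, q x ≤ C * ‖x‖ ^ 2) {i : ℕ}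
    {V : Submodule ℂ E} (hV : finrank ℂ V = i + 1) (hc : ∀ x ∈ V, c * ‖x‖ ^ 2 ≤ q x) : c ≤ C := by
  obtain ⟨x, hx, hx0⟩ := exists_mem_ne_zero_of_finrank_succ hV
  have hpos : 0 < ‖x‖ ^ 2 := by positivity
  exact le_of_mul_le_mul_right ((hc x hx).trans (hq x)) hpos

theorem le_maxMin {q : E → ℝ} {C c : ℝ} (hq : ∀ x, q x ≤ C * ‖x‖ ^ 2) {i : ℕ}
    {V : Submodule ℂ E} (hV : finrank ℂ V = i + 1) (hc : ∀ x ∈ V, c * ‖x‖ ^ 2 ≤ q x) :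
    c ≤ maxMin q i :=
  le_csSup ⟨C, by rintro _ ⟨W, hW, h⟩; exact le_of_forall_mem_bound hq hW h⟩ ⟨V, hV, hc⟩

/-- The bound `0 ≤ B` covers both the value `sSup ∅ = 0`, taken when no subspace has the required
dimension, and all constants `c ≤ 0`. -/
theorem maxMin_le {q : E → ℝ} {B : ℝ} (hB : 0 ≤ B) {i : ℕ}
    (h : ∀ (c : ℝ) (V : Submodule ℂ E), 0 < c → finrank ℂ V = i + 1 →
      (∀ x ∈ V, c * ‖x‖ ^ 2 ≤ q x) → c ≤ B) : maxMin q i ≤ B := by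
  refine Real.sSup_le ?_ hB
  rintro c ⟨V, hV, hc⟩
  rcases le_or_gt c 0 with h0 | h0
  · exact h0.trans hB
  · exact h c V h0 hV hc

theorem maxMin_nonneg {q : E → ℝ} (hq : ∀ x, 0 ≤ q x) (i : ℕ) : 0 ≤ maxMin q i := by
  by_cases hne : ∃ V : Submodule ℂ E, finrank ℂ V = i + 1
  · obtain ⟨V, hV⟩ := hne
    exact Real.sSup_nonneg' ⟨0, ⟨V, hV, fun x _ => by simpa using hq x⟩, le_rfl⟩
  · refine Real.sSup_nonneg ?_
    rintro c ⟨V, hV, -⟩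
    exact absurd ⟨V, hV⟩ hne

/-- A subspace that admits `c` for `q` admits `c - ε` for `q'`. -/
theorem maxMin_le_add {q q' : E → ℝ} {C ε : ℝ} (hq' : ∀ x, q' x ≤ C * ‖x‖ ^ 2)
    (h0 : ∀ x, 0 ≤ q' x) (hε : 0 ≤ ε) (h : ∀ x, q x ≤ q' x + ε * ‖x‖ ^ 2) (i : ℕ) :
    maxMin q i ≤ maxMin q' i + ε := by
  refine maxMin_le (add_nonneg (maxMin_nonneg h0 i) hε) fun c V _ hV hc => ?_
  have : c - ε ≤ maxMin q' i := le_maxMin hq' hV fun x hx => by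
    have h1 := hc x hx
    have h2 := h x
    linarith [sub_mul c ε (‖x‖ ^ 2)]
  linarith

theorem maxMin_const_mul_le {q : E → ℝ} {C t : ℝ} (hq : ∀ x, q x ≤ C * ‖x‖ ^ 2)
    (h0 : ∀ x, 0 ≤ q x) (ht : 0 < t) (i : ℕ) :
    maxMin (fun x => t * q x) i ≤ t * maxMin q i := by
  refine maxMin_le (mul_nonneg ht.le (maxMin_nonneg h0 i)) fun c V _ hV hc => ?_
  have : c / t ≤ maxMin q i := le_maxMin hq hV fun x hx => by
    rw [div_mul_eq_mul_div, div_le_iff₀ ht, mul_comm (q x)]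
    exact hc x hx
  rwa [div_le_iff₀ ht, mul_comm] at this

theorem maxMin_const_mul {q : E → ℝ} {C t : ℝ} (hq : ∀ x, q x ≤ C * ‖x‖ ^ 2)
    (h0 : ∀ x, 0 ≤ q x) (ht : 0 < t) (i : ℕ) :
    maxMin (fun x => t * q x) i = t * maxMin q i := by
  refine le_antisymm (maxMin_const_mul_le hq h0 ht i) ?_
  have h := maxMin_const_mul_le (q := fun x => t * q x) (C := t * C) (t := t⁻¹)
    (fun x => by rw [mul_assoc]; exact mul_le_mul_of_nonneg_left (hq x) ht.le)
    (fun x => mul_nonneg ht.le (h0 x)) (inv_pos.2 ht) i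
  simp only [inv_mul_cancel_left₀ ht.ne'] at h
  rwa [← div_eq_inv_mul, le_div_iff₀ ht, mul_comm] at h

/-- Convergence of forms, uniformly on the unit ball, implies convergence of their eigenvalues. -/
theorem tendsto_maxMin {q : ℕ → E → ℝ} {q₀ : E → ℝ} {ε : ℕ → ℝ} {C : ℝ}
    (h0 : ∀ n x, 0 ≤ q n x) (h0' : ∀ x, 0 ≤ q₀ x) (hC : ∀ x, q₀ x ≤ C * ‖x‖ ^ 2)
    (hε : Tendsto ε atTop (𝓝 0)) (h : ∀ᶠ n in atTop, ∀ x, |q n x - q₀ x| ≤ ε n * ‖x‖ ^ 2) (i : ℕ) :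
    Tendsto (fun n => maxMin (q n) i) atTop (𝓝 (maxMin q₀ i)) := by
  rw [tendsto_iff_dist_tendsto_zero]
  refine squeeze_zero' (Eventually.of_forall fun n => dist_nonneg) ?_ (by simpa using hε.abs)
  filter_upwards [h] with n hn
  have hn' : ∀ x, |q n x - q₀ x| ≤ |ε n| * ‖x‖ ^ 2 := fun x =>
    (hn x).trans (mul_le_mul_of_nonneg_right (le_abs_self _) (by positivity))
  rw [Real.dist_eq, abs_le]
  have h1 := maxMin_le_add (q := q n) hC h0' (abs_nonneg (ε n))
    (fun x => by linarith [(abs_le.1 (hn' x)).2]) i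
  have h2 := maxMin_le_add (q := q₀) (q' := q n) (C := C + |ε n|)
    (fun x => by linarith [(abs_le.1 (hn' x)).2, hC x, add_mul C |ε n| (‖x‖ ^ 2)]) (h0 n)
    (abs_nonneg (ε n)) (fun x => by linarith [(abs_le.1 (hn' x)).1]) i
  constructor <;> linarith

variable {F : Type*} [NormedAddCommGroup F] [InnerProductSpace ℂ F]

theorem LinearMap.exists_norm_sq_le [FiniteDimensional ℂ E] (T : E →ₗ[ℂ] F) :
    ∃ C : ℝ, ∀ x, ‖T x‖ ^ 2 ≤ C * ‖x‖ ^ 2 := by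
  refine ⟨‖LinearMap.toContinuousLinearMap T‖ ^ 2, fun x => ?_⟩
  rw [← mul_pow]
  exact pow_le_pow_left₀ (norm_nonneg _) ((LinearMap.toContinuousLinearMap T).le_opNorm x) 2

theorem norm_sq_apply_eq_sum_eigenvalues [FiniteDimensional ℂ E] [FiniteDimensional ℂ F]
    (T : E →ₗ[ℂ] F) {n : ℕ} (hn : finrank ℂ E = n) (x : E) :
    ‖T x‖ ^ 2 = ∑ j, T.isSymmetric_adjoint_comp_self.eigenvalues hn j *
      ‖inner ℂ (T.isSymmetric_adjoint_comp_self.eigenvectorBasis hn j) x‖ ^ 2 := by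
  set hS := T.isSymmetric_adjoint_comp_self
  set b := hS.eigenvectorBasis hn
  have h1 : inner ℂ (T x) (T x) = inner ℂ x ((LinearMap.adjoint T ∘ₗ T) x) := by
    simp [LinearMap.adjoint_inner_right]
  have h2 : ∀ j, inner ℂ (b j) ((LinearMap.adjoint T ∘ₗ T) x)
      = (hS.eigenvalues hn j : ℂ) * inner ℂ (b j) x := fun j => by
    rw [← hS (b j) x, hS.apply_eigenvectorBasis hn j, inner_smul_left]
    exact congrArg (· * _) (Complex.conj_ofReal _)
  have h3 := b.sum_inner_mul_inner x ((LinearMap.adjoint T ∘ₗ T) x)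
  rw [← h1, inner_self_eq_norm_sq_to_K] at h3
  simp only [h2] at h3
  have h4 : ∀ j, inner ℂ x (b j) * ((hS.eigenvalues hn j : ℂ) * inner ℂ (b j) x)
      = ((hS.eigenvalues hn j * ‖inner ℂ (b j) x‖ ^ 2 : ℝ) : ℂ) := fun j => by
    rw [← inner_conj_symm x (b j), mul_left_comm, Complex.conj_mul']
    push_cast
    rfl
  simp only [h4] at h3
  rw [← Complex.ofReal_sum] at h3
  exact Complex.ofReal_injective (by simpa using h3.symm)

/-- The Courant–Fischer principle for singular values. -/
theorem sq_singularValues_eq_maxMin [FiniteDimensional ℂ E] [FiniteDimensional ℂ F]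
    (T : E →ₗ[ℂ] F) (i : ℕ) : T.singularValues i ^ 2 = maxMin (fun x => ‖T x‖ ^ 2) i := by
  obtain ⟨C, hC⟩ := T.exists_norm_sq_le
  rcases le_or_gt (finrank ℂ E) i with hi | hi
  -- Beyond the dimension the singular value is zero by convention, and no test subspace exists.
  · rw [T.singularValues_of_finrank_le hi]
    refine le_antisymm (by simpa using maxMin_nonneg (fun x => by positivity) i) ?_
    refine maxMin_le (by simp) fun c V _ hV _ => ?_
    have := V.finrank_le
    omega
  set n := finrank ℂ E with hn
  set b := T.isSymmetric_adjoint_comp_self.eigenvectorBasis hn.symm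
  set e := T.isSymmetric_adjoint_comp_self.eigenvalues hn.symm
  have hanti : Antitone e := T.isSymmetric_adjoint_comp_self.eigenvalues_antitone hn.symm
  rw [T.sq_singularValues_of_lt hn.symm hi]
  have hT : ∀ x, ‖T x‖ ^ 2 = ∑ j, e j * ‖inner ℂ (b j) x‖ ^ 2 :=
    norm_sq_apply_eq_sum_eigenvalues T hn.symm
  have hx : ∀ x : E, ‖x‖ ^ 2 = ∑ j, ‖inner ℂ (b j) x‖ ^ 2 := fun x =>
    (b.sum_sq_norm_inner_right x).symm
  have hpos : 0 ≤ e ⟨i, hi⟩ := T.isPositive_adjoint_comp_self.nonneg_eigenvalues hn.symm _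
  have hspan : ∀ (s : Set (Fin n)) (j : Fin n), j ∉ s → ∀ x ∈ Submodule.span ℂ (b '' s),
      inner ℂ (b j) x = 0 := by
    intro s j hj x hxs
    induction hxs using Submodule.span_induction with
    | mem x hx =>
      obtain ⟨k, hk, rfl⟩ := hx
      exact b.orthonormal.2 fun h => hj (h ▸ hk)
    | zero => simp
    | add x y _ _ hx hy => rw [inner_add_right, hx, hy, add_zero]
    | smul a x _ hx => rw [inner_smul_right, hx, mul_zero]
  have hrank : ∀ s : Finset (Fin n), finrank ℂ (Submodule.span ℂ (b '' (s : Set (Fin n))))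
      = s.card := by
    intro s
    have := finrank_span_eq_card (R := ℂ) (b := fun j : s => b j)
      (b.orthonormal.linearIndependent.comp _ Subtype.val_injective)
    rw [Fintype.card_coe] at this
    rw [← this, Set.image_eq_range]
    rfl
  apply le_antisymm
  · refine le_maxMin hC (V := Submodule.span ℂ (b '' (Finset.Iic (⟨i, hi⟩ : Fin n)))) ?_ ?_
    · rw [hrank]; simp
    · intro x hxV
      rw [hT, hx, Finset.mul_sum]
      refine Finset.sum_le_sum fun j _ => ?_
      by_cases hj : j ≤ ⟨i, hi⟩
      · exact mul_le_mul_of_nonneg_right (hanti hj) (by positivity)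
      · rw [hspan _ j (by simpa using hj) x hxV]; simp
  · refine maxMin_le hpos fun c V _ hV hc => ?_
    set W := Submodule.span ℂ (b '' (Finset.Ici (⟨i, hi⟩ : Fin n))) with hW
    have hWr : finrank ℂ W = n - i := by rw [hW, hrank]; simp
    -- Since `(i + 1) + (n - i) > n`, the subspace `V` meets the span of the eigenvectors with index
    -- at least `i`.
    have hinf : V ⊓ W ≠ ⊥ := by
      intro h
      have h1 := Submodule.finrank_sup_add_finrank_inf_eq V W
      have h2 := (V ⊔ W).finrank_le
      rw [h, finrank_bot] at h1
      omega
    obtain ⟨x, hxVW, hx0⟩ := (V ⊓ W).exists_mem_ne_zero_of_ne_bot hinf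
    have hxp : 0 < ‖x‖ ^ 2 := by positivity
    refine le_of_mul_le_mul_right ((hc x hxVW.1).trans ?_) hxp
    rw [hT, hx, Finset.mul_sum]
    refine Finset.sum_le_sum fun j _ => ?_
    by_cases hj : ⟨i, hi⟩ ≤ j
    · exact mul_le_mul_of_nonneg_right (hanti hj) (by positivity)
    · rw [hspan _ j (by simpa using hj) x hxVW.2]; simp

/-- If `T` is bounded below by `c > 0` on `V`, it is injective there, so `V.map T` has the same
dimension. On it `‖T x‖² ≤ ‖T* T x‖ ‖x‖` gives the same bound for the adjoint. -/
theorem maxMin_le_maxMin_adjoint [FiniteDimensional ℂ E] [FiniteDimensional ℂ F]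
    (T : E →ₗ[ℂ] F) (i : ℕ) :
    maxMin (fun x => ‖T x‖ ^ 2) i ≤ maxMin (fun y => ‖LinearMap.adjoint T y‖ ^ 2) i := by
  obtain ⟨C, hC⟩ := (LinearMap.adjoint T).exists_norm_sq_le
  refine maxMin_le (maxMin_nonneg (fun x => by positivity) i) fun c V hc0 hV hc => ?_
  have hker : Disjoint V (LinearMap.ker T) := by
    rw [Submodule.disjoint_def]
    intro x hx hxT
    have h1 := hc x hx
    rw [LinearMap.mem_ker.1 hxT] at h1
    by_contra h0
    have : 0 < c * ‖x‖ ^ 2 := by positivity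
    simp at h1
    linarith
  have hinj : Function.Injective (T.domRestrict V) := by
    rw [injective_iff_map_eq_zero]
    exact fun x hx => Subtype.ext (Submodule.disjoint_def.1 hker x x.2 hx)
  refine le_maxMin hC (V := V.map T) ?_ ?_
  · rw [← hV, ← LinearMap.range_domRestrict]
    exact LinearMap.finrank_range_of_inj hinj
  · rintro _ ⟨x, hx, rfl⟩
    rcases eq_or_ne x 0 with rfl | h0
    · simp
    have hxp : 0 < ‖x‖ ^ 2 := by positivity
    have h1 : ‖T x‖ ^ 2 ≤ ‖LinearMap.adjoint T (T x)‖ * ‖x‖ := by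
      have : ‖inner ℂ (LinearMap.adjoint T (T x)) x‖ = ‖T x‖ ^ 2 := by
        rw [LinearMap.adjoint_inner_left, inner_self_eq_norm_sq_to_K]; simp
      rw [← this]
      exact norm_inner_le_norm _ _
    have h2 : (‖T x‖ ^ 2) ^ 2 ≤ (‖LinearMap.adjoint T (T x)‖ * ‖x‖) ^ 2 :=
      pow_le_pow_left₀ (by positivity) h1 2
    refine le_of_mul_le_mul_right ?_ hxp
    calc c * ‖T x‖ ^ 2 * ‖x‖ ^ 2 = (c * ‖x‖ ^ 2) * ‖T x‖ ^ 2 := by ring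
      _ ≤ ‖T x‖ ^ 2 * ‖T x‖ ^ 2 := mul_le_mul_of_nonneg_right (hc x hx) (by positivity)
      _ = (‖T x‖ ^ 2) ^ 2 := by ring
      _ ≤ _ := h2
      _ = _ := by ring

/-- Moves the form to the codomain, which for trajectory matrices does not change with `M`. -/
theorem sq_singularValues_eq_maxMin_adjoint [FiniteDimensional ℂ E] [FiniteDimensional ℂ F]
    (T : E →ₗ[ℂ] F) (i : ℕ) :
    T.singularValues i ^ 2 = maxMin (fun y => ‖LinearMap.adjoint T y‖ ^ 2) i := by
  rw [sq_singularValues_eq_maxMin]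
  refine le_antisymm (maxMin_le_maxMin_adjoint T i) ?_
  simpa using maxMin_le_maxMin_adjoint (LinearMap.adjoint T) i

end MinMax

/-! ### Compactness of positive operators with bounded trace. -/

section TraceClass

variable {H : Type*} [NormedAddCommGroup H] [InnerProductSpace ℂ H]

/-- Positivity of the form at `x - M⁻¹ S x`, expanded. The `+ 1` keeps `M` invertible when `S = 0`.
-/
theorem ContinuousLinearMap.norm_apply_sq_le_of_nonneg {S : H →L[ℂ] H}
    (hsymm : S.IsSymmetric) (hpos : ∀ x, 0 ≤ (inner ℂ x (S x)).re) (x : H) :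
    ‖S x‖ ^ 2 ≤ (‖S‖ + 1) * (inner ℂ x (S x)).re := by
  set M := ‖S‖ + 1
  have hM : 0 < M := by positivity
  have hSx : (inner ℂ (S x) (S (S x))).re ≤ M * ‖S x‖ ^ 2 := by
    calc (inner ℂ (S x) (S (S x))).re ≤ ‖inner ℂ (S x) (S (S x))‖ := Complex.re_le_norm _
      _ ≤ ‖S x‖ * ‖S (S x)‖ := norm_inner_le_norm _ _
      _ ≤ ‖S x‖ * (M * ‖S x‖) := by
        gcongr
        exact (S.le_opNorm _).trans (by gcongr; simp [M])
      _ = M * ‖S x‖ ^ 2 := by ring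
  have h := hpos (x - (M⁻¹ : ℂ) • S x)
  have e1 : inner ℂ x (S (S x)) = ((‖S x‖ ^ 2 : ℝ) : ℂ) := by
    have h := hsymm x (S x)
    simp only [ContinuousLinearMap.coe_coe] at h
    rw [← h, inner_self_eq_norm_sq_to_K]; simp
  have e2 : inner ℂ (S x) (S x) = ((‖S x‖ ^ 2 : ℝ) : ℂ) := by
    rw [inner_self_eq_norm_sq_to_K]; simp
  have key : (inner ℂ (x - (M⁻¹ : ℂ) • S x) (S (x - (M⁻¹ : ℂ) • S x))).re
      = (inner ℂ x (S x)).re - 2 * M⁻¹ * ‖S x‖ ^ 2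
        + M⁻¹ ^ 2 * (inner ℂ (S x) (S (S x))).re := by
    simp only [map_sub, map_smul, inner_sub_left, inner_sub_right, inner_smul_left,
      inner_smul_right, e1, e2]
    have : conj (M⁻¹ : ℂ) = ((M⁻¹ : ℝ) : ℂ) := by rw [← Complex.ofReal_inv, Complex.conj_ofReal]
    rw [this, ← Complex.ofReal_inv]
    simp only [Complex.sub_re, Complex.re_ofReal_mul, Complex.ofReal_re]
    ring
  rw [key] at h
  have h2 : M⁻¹ ^ 2 * (inner ℂ (S x) (S (S x))).re ≤ M⁻¹ * ‖S x‖ ^ 2 := by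
    calc _ ≤ M⁻¹ ^ 2 * (M * ‖S x‖ ^ 2) := by gcongr
      _ = _ := by field_simp
  have h3 : M⁻¹ * ‖S x‖ ^ 2 ≤ (inner ℂ x (S x)).re := by linarith
  rwa [inv_mul_le_iff₀ hM] at h3

/-- A positive operator of finite trace is compact. -/
theorem isCompactOperator_of_trace_le [CompleteSpace H] {S : H →L[ℂ] H}
    (hsymm : S.IsSymmetric) (hpos : ∀ x, 0 ≤ (inner ℂ x (S x)).re) {C : ℝ}
    (htr : ∀ (n : ℕ) (e : Fin n → H), Orthonormal ℂ e → ∑ i, (inner ℂ (e i) (S (e i))).re ≤ C) :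
    IsCompactOperator S := by
  let A : Set ℝ := {t | ∃ (n : ℕ) (e : Fin n → H), Orthonormal ℂ e ∧
    t = ∑ i, (inner ℂ (e i) (S (e i))).re}
  have hA : BddAbove A := ⟨C, by rintro _ ⟨n, e, he, rfl⟩; exact htr n e he⟩
  have hAne : A.Nonempty := ⟨_, 0, Fin.elim0, by simp [Orthonormal, Subsingleton.pairwise], rfl⟩
  have hclosed := isClosed_setOfPred_isCompactOperator (𝕜₁ := ℂ) (σ₁₂ := RingHom.id ℂ)
    (M₁ := H) (M₂ := H)
  change S ∈ {f : H →L[ℂ] H | IsCompactOperator f}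
  rw [← hclosed.closure_eq, Metric.mem_closure_iff]
  intro ε hε
  set M := ‖S‖ + 1 with hMdef
  have hM : 0 < M := by positivity
  -- Choose a finite orthonormal family whose partial trace is nearly the supremum. A further unit
  -- vector orthogonal to it can add at most `(ε / 2) ^ 2 / M`, which forces `S` to be small on the
  -- complement.
  obtain ⟨_, ⟨n, e, he, rfl⟩, hlt⟩ := exists_lt_of_lt_csSup hAne
    (show sSup A - (ε / 2) ^ 2 / M < sSup A by
      have : 0 < (ε / 2) ^ 2 / M := by positivity
      linarith)
  set U := Submodule.span ℂ (Set.range e) with hU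
  have : FiniteDimensional ℂ U := FiniteDimensional.span_of_finite ℂ (Set.finite_range e)
  have hperp : ∀ x ∈ Uᗮ, ‖S x‖ ≤ ε / 2 * ‖x‖ := by
    intro x hx
    rcases eq_or_ne x 0 with rfl | hx0
    · simp
    have hxn : 0 < ‖x‖ := norm_pos_iff.2 hx0
    set u : H := ((‖x‖ : ℂ)⁻¹) • x with hu
    have hun : ‖u‖ = 1 := by
      rw [hu, norm_smul]; simp [hxn.ne']
    have hue : ∀ i, inner ℂ (e i) u = 0 := fun i => by
      rw [hu, inner_smul_right, Submodule.mem_orthogonal U x |>.1 hx (e i)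
        (Submodule.subset_span ⟨i, rfl⟩), mul_zero]
    have hon : Orthonormal ℂ (Fin.cons u e : Fin (n + 1) → H) := by
      constructor
      · intro i
        refine Fin.cases ?_ (fun j => ?_) i
        · simpa using hun
        · simpa using he.1 j
      · intro i j hij
        induction i using Fin.cases with
        | zero =>
          induction j using Fin.cases with
          | zero => exact absurd rfl hij
          | succ j => simpa using inner_eq_zero_symm.1 (hue j)
        | succ i =>
          induction j using Fin.cases with
          | zero => simpa using hue i
          | succ j => simpa using he.2 fun h => hij (by rw [h])
    have hle := le_csSup hA ⟨n + 1, _, hon, rfl⟩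
    rw [Fin.sum_univ_succ] at hle
    simp only [Fin.cons_zero, Fin.cons_succ] at hle
    have h1 : (inner ℂ u (S u)).re ≤ (ε / 2) ^ 2 / M := by linarith
    have h2 := S.norm_apply_sq_le_of_nonneg hsymm hpos u
    have h3 : ‖S u‖ ^ 2 ≤ (ε / 2) ^ 2 := by
      calc _ ≤ M * (inner ℂ u (S u)).re := h2
        _ ≤ M * ((ε / 2) ^ 2 / M) := by gcongr
        _ = _ := by field_simp
    have h4 : ‖S u‖ ≤ ε / 2 := le_of_sq_le_sq h3 (by positivity)
    have h5 : x = (‖x‖ : ℂ) • u := by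
      rw [hu, smul_smul, mul_inv_cancel₀ (by exact_mod_cast hxn.ne'), one_smul]
    rw [h5, map_smul, norm_smul, norm_smul, hun, mul_one, mul_comm]
    gcongr
  -- The finite-rank approximant within `ε` of `S`.
  refine ⟨S ∘L U.starProjection, ?_, ?_⟩
  · change IsCompactOperator _
    have : ProperSpace U := FiniteDimensional.proper ℂ U
    exact (isCompactOperator_of_locallyCompactSpace_dom U.orthogonalProjectionOnto).clm_comp
      (S ∘L U.subtypeL)
  · rw [dist_eq_norm]
    refine lt_of_le_of_lt (ContinuousLinearMap.opNorm_le_bound _ (by positivity : 0 ≤ ε / 2) ?_)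
      (half_lt_self hε)
    intro x
    have hx : x - U.starProjection x ∈ Uᗮ := U.sub_starProjection_mem_orthogonal x
    have hx2 : ‖x - U.starProjection x‖ ≤ ‖x‖ := by
      rw [← U.starProjection_orthogonal_val]
      exact Uᗮ.norm_starProjection_apply_le x
    calc ‖(S - S ∘L U.starProjection) x‖ = ‖S (x - U.starProjection x)‖ := by simp
      _ ≤ ε / 2 * ‖x - U.starProjection x‖ := hperp _ hx
      _ ≤ _ := by gcongr

end TraceClass

/-! ### Weak mixing of vectors orthogonal to all eigenvectors. -/

section WeakMixing

variable {H : Type*} [NormedAddCommGroup H] [InnerProductSpace ℂ H]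

theorem LinearIsometry.inner_iterate_iterate (K : H →ₗᵢ[ℂ] H) (k : ℕ) (x y : H) :
    inner ℂ (K^[k] x) (K^[k] y) = inner ℂ x y := by
  induction k with
  | zero => rfl
  | succ k ih => rw [Function.iterate_succ_apply', Function.iterate_succ_apply',
      K.inner_map_map, ih]

theorem LinearIsometry.norm_iterate (K : H →ₗᵢ[ℂ] H) (k : ℕ) (x : H) : ‖K^[k] x‖ = ‖x‖ := by
  induction k with
  | zero => rfl
  | succ k ih => rw [Function.iterate_succ_apply', K.norm_map, ih]

theorem LinearIsometry.norm_eigenvalue (K : H →ₗᵢ[ℂ] H) {w : H} {z : ℂ} (hw : w ≠ 0)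
    (h : K w = z • w) : ‖z‖ = 1 := by
  have h1 : ‖z‖ * ‖w‖ = 1 * ‖w‖ := by rw [← norm_smul, ← h, K.norm_map, one_mul]
  exact mul_right_cancel₀ (norm_ne_zero_iff.2 hw) h1

/-- An eigenvector of an isometry is also one of the adjoint, with conjugate eigenvalue, because
`|z| = 1`; surjectivity of `K` plays no role. -/
theorem LinearIsometry.inner_eigenvector_iterate (K : H →ₗᵢ[ℂ] H) {w : H} {z : ℂ}
    (h : K w = z • w) (k : ℕ) (x : H) : inner ℂ w (K^[k] x) = z ^ k * inner ℂ w x := by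
  rcases eq_or_ne w 0 with rfl | hw
  · simp
  have hz : z * conj z = 1 := by rw [Complex.mul_conj', K.norm_eigenvalue hw h]; simp
  induction k with
  | zero => simp
  | succ k ih =>
    have h1 : inner ℂ (z • w) (K (K^[k] x)) = inner ℂ w (K^[k] x) := by
      rw [← h, K.inner_map_map]
    rw [inner_smul_left, ih] at h1
    rw [Function.iterate_succ_apply', pow_succ', mul_assoc, ← h1, ← mul_assoc, hz, one_mul]

/-- The averages over `k < N` of the forms `⟨x, Kᵏ r⟩ ⟨Kᵏ r, y⟩`. -/
noncomputable def orbitForm (K : H →ₗᵢ[ℂ] H) (r : H) (N : ℕ) (x y : H) : ℂ :=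
  (N : ℂ)⁻¹ * ∑ k ∈ Finset.range N, inner ℂ x (K^[k] r) * inner ℂ (K^[k] r) y

variable (K : H →ₗᵢ[ℂ] H) (r : H)

theorem norm_orbit_term_le (k : ℕ) (x y : H) :
    ‖inner ℂ x (K^[k] r) * inner ℂ (K^[k] r) y‖ ≤ ‖r‖ ^ 2 * ‖x‖ * ‖y‖ := by
  rw [norm_mul]
  calc _ ≤ (‖x‖ * ‖K^[k] r‖) * (‖K^[k] r‖ * ‖y‖) := by
        gcongr <;> exact norm_inner_le_norm _ _
    _ = _ := by rw [K.norm_iterate]; ring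

theorem norm_orbitForm_le (N : ℕ) (x y : H) :
    ‖orbitForm K r N x y‖ ≤ ‖r‖ ^ 2 * ‖x‖ * ‖y‖ := by
  rcases eq_or_ne N 0 with rfl | hN
  · simp only [orbitForm, Finset.range_zero, Finset.sum_empty, mul_zero, norm_zero]
    positivity
  rw [orbitForm, norm_mul, norm_inv, Complex.norm_natCast, inv_mul_le_iff₀ (by positivity)]
  refine (norm_sum_le _ _).trans ?_
  refine (Finset.sum_le_card_nsmul _ _ _ fun k _ => norm_orbit_term_le K r k x y).trans ?_
  simp

theorem orbitForm_conj (N : ℕ) (x y : H) :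
    conj (orbitForm K r N x y) = orbitForm K r N y x := by
  simp only [orbitForm, map_mul, map_sum, inner_conj_symm, map_inv₀, map_natCast]
  simp only [mul_comm]

theorem orbitForm_self (N : ℕ) (x : H) :
    orbitForm K r N x x
      = (((N : ℝ)⁻¹ * ∑ k ∈ Finset.range N, ‖inner ℂ (K^[k] r) x‖ ^ 2 : ℝ) : ℂ) := by
  rw [orbitForm]
  push_cast
  congr 1
  refine Finset.sum_congr rfl fun k _ => ?_
  rw [← inner_conj_symm x, Complex.conj_mul']

/-- Bessel's inequality for each `Kᵏ r`, all of which have norm `‖r‖`. -/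
theorem orbitForm_trace_le (N : ℕ) {n : ℕ} {e : Fin n → H} (he : Orthonormal ℂ e) :
    ∑ i, (orbitForm K r N (e i) (e i)).re ≤ ‖r‖ ^ 2 := by
  simp only [orbitForm_self, Complex.ofReal_re]
  rw [← Finset.mul_sum, Finset.sum_comm]
  rcases eq_or_ne N 0 with rfl | hN
  · simp
  rw [inv_mul_le_iff₀ (by positivity)]
  refine (Finset.sum_le_card_nsmul _ _ (‖r‖ ^ 2) fun k _ => ?_).trans (by simp)
  have := he.sum_inner_products_le (K^[k] r) (s := Finset.univ)
  rw [K.norm_iterate] at this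
  simpa only [norm_inner_symm] using this

/-- Moving `K` across the form raises the index `k` by one, so the difference telescopes to two
bounded boundary terms divided by `N`. In the limit this says that the limit operator commutes with
`K`. -/
theorem tendsto_orbitForm_sub [CompleteSpace H] (x y : H) :
    Tendsto (fun N => orbitForm K r N x (K y) -
      orbitForm K r N (K.toContinuousLinearMap.adjoint x) y) atTop (𝓝 0) := by
  set g : ℕ → ℂ := fun k => inner ℂ x (K^[k] r) * inner ℂ (K^[k] r) (K y) with hg
  have h : ∀ N, orbitForm K r N x (K y) - orbitForm K r N (K.toContinuousLinearMap.adjoint x) y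
      = (N : ℂ)⁻¹ * (g 0 - g N) := fun N => by
    rw [orbitForm, orbitForm, ← mul_sub]
    congr 1
    have : ∀ k, inner ℂ (K.toContinuousLinearMap.adjoint x) (K^[k] r) * inner ℂ (K^[k] r) y
        = g (k + 1) := fun k => by
      rw [ContinuousLinearMap.adjoint_inner_left, hg]
      simp only [Function.iterate_succ_apply', K.inner_map_map]
      rfl
    simp only [this]
    rw [← Finset.sum_sub_distrib, ← neg_sub, ← Finset.sum_range_sub, ← Finset.sum_neg_distrib]
    simp [hg]
  simp only [h]
  rw [tendsto_zero_iff_norm_tendsto_zero]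
  have hb : ∀ N : ℕ, ‖(N : ℂ)⁻¹ * (g 0 - g N)‖
      ≤ (N : ℝ)⁻¹ * (2 * (‖r‖ ^ 2 * ‖x‖ * ‖K y‖)) := fun N => by
    rw [norm_mul, norm_inv, Complex.norm_natCast]
    gcongr
    refine (norm_sub_le _ _).trans ?_
    have h1 := norm_orbit_term_le K r 0 x (K y)
    have h2 := norm_orbit_term_le K r N x (K y)
    simp only [hg]
    linarith
  refine squeeze_zero (fun _ => norm_nonneg _) hb ?_
  simpa using (tendsto_inv_atTop_nhds_zero_nat (𝕜 := ℝ)).mul_const (2 * (‖r‖ ^ 2 * ‖x‖ * ‖K y‖))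

/-- Along an ultrafilter, the averaged forms converge to the form of a bounded operator. -/
theorem exists_tendsto_orbitForm [CompleteSpace H] (U : Ultrafilter ℕ) :
    ∃ S : H →L[ℂ] H, ∀ x y, Tendsto (fun N => orbitForm K r N x y) U (𝓝 (inner ℂ (S x) y)) := by
  have hlim : ∀ x y, ∃ c, ‖c‖ ≤ ‖r‖ ^ 2 * ‖x‖ * ‖y‖ ∧
      Tendsto (fun N => orbitForm K r N x y) U (𝓝 c) := by
    intro x y
    have hc := isCompact_closedBall (0 : ℂ) (‖r‖ ^ 2 * ‖x‖ * ‖y‖)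
    obtain ⟨c, hc1, hc2⟩ := hc.ultrafilter_le_nhds (U.map fun N => orbitForm K r N x y)
      (by
        rw [le_principal_iff]
        exact Filter.mem_map.2 (univ_mem' fun N => by simpa using norm_orbitForm_le K r N x y))
    exact ⟨c, by simpa using hc1, hc2⟩
  choose φ hφ hφt using hlim
  let B : H →ₗ⋆[ℂ] H →ₗ[ℂ] ℂ := LinearMap.mk₂'ₛₗ (starRingEnd ℂ) (RingHom.id ℂ) φ
    (fun x x' y => tendsto_nhds_unique (hφt _ _) (((hφt x y).add (hφt x' y)).congr fun N => by
      simp [orbitForm, add_mul, Finset.sum_add_distrib, mul_add]))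
    (fun c x y => tendsto_nhds_unique (hφt _ _) (((hφt x y).const_mul (conj c)).congr fun N => by
      simp only [orbitForm, inner_smul_left, mul_assoc, ← Finset.mul_sum]
      rw [mul_left_comm]))
    (fun x y y' => tendsto_nhds_unique (hφt _ _) (((hφt x y).add (hφt x y')).congr fun N => by
      simp [orbitForm, mul_add, Finset.sum_add_distrib]))
    (fun c x y => tendsto_nhds_unique (hφt _ _) (((hφt x y).const_mul c).congr fun N => by
      simp only [orbitForm, inner_smul_right, mul_left_comm _ c, ← Finset.mul_sum]))
  let B' : H →L⋆[ℂ] H →L[ℂ] ℂ := B.mkContinuous₂ (‖r‖ ^ 2) fun x y => hφ x y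
  refine ⟨InnerProductSpace.continuousLinearMapOfBilin B', fun x y => ?_⟩
  rw [InnerProductSpace.continuousLinearMapOfBilin_apply]
  exact hφt x y

/-- A vector orthogonal to all eigenvectors of an isometry is weakly mixing. -/
theorem tendsto_average_sq_norm_inner_iterate [CompleteSpace H]
    (hr : ∀ (z : ℂ) (w : H), K w = z • w → inner ℂ w r = 0) :
    Tendsto (fun N : ℕ => (N : ℝ)⁻¹ * ∑ k ∈ Finset.range N, ‖inner ℂ (K^[k] r) r‖ ^ 2)
      atTop (𝓝 0) := by
  rw [tendsto_iff_ultrafilter]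
  intro U hU
  obtain ⟨S, hS⟩ := exists_tendsto_orbitForm K r U
  have hsymm : S.IsSymmetric := fun x y => by
    have h1 := (Complex.continuous_conj.tendsto _).comp (hS y x)
    rw [inner_conj_symm] at h1
    exact tendsto_nhds_unique (hS x y) (h1.congr fun N => orbitForm_conj K r N y x)
  have hS' : ∀ x y, Tendsto (fun N => orbitForm K r N x y) U (𝓝 (inner ℂ x (S y))) :=
    fun x y => by
      have := hsymm x y
      simp only [ContinuousLinearMap.coe_coe] at this
      rw [← this]
      exact hS x y
  have hre : ∀ x, Tendsto (fun N => (orbitForm K r N x x).re) U (𝓝 (inner ℂ x (S x)).re) :=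
    fun x => (Complex.continuous_re.tendsto _).comp (hS' x x)
  have hpos : ∀ x, 0 ≤ (inner ℂ x (S x)).re := fun x =>
    ge_of_tendsto' (hre x) fun N => by
      rw [orbitForm_self, Complex.ofReal_re]
      positivity
  have hcomp : IsCompactOperator S :=
    isCompactOperator_of_trace_le hsymm hpos (C := ‖r‖ ^ 2) fun n e he =>
      le_of_tendsto' (tendsto_finsetSum _ fun i _ => hre (e i)) fun N =>
        orbitForm_trace_le K r N he
  have hcomm : ∀ y, S (K y) = K (S y) := fun y => by
    refine ext_inner_left ℂ fun x => ?_
    have h1 := (hS' x (K y)).sub (hS' (K.toContinuousLinearMap.adjoint x) y)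
    have h2 := tendsto_nhds_unique h1 ((tendsto_orbitForm_sub K r x y).mono_left hU)
    rw [ContinuousLinearMap.adjoint_inner_left] at h2
    exact sub_eq_zero.1 h2
  -- A compact symmetric operator whose only eigenvalue is `0` vanishes; a nonzero eigenvalue would
  -- yield an eigenvector of `K` inside its finite-dimensional eigenspace.
  have hzero : S = 0 := by
    rw [← ContinuousLinearMap.eq_zero_of_forall_hasEigenvalue_eq_zero hcomp hsymm]
    intro μ hμ
    by_contra hμ0
    have hfin := ContinuousLinearMap.finite_dimensional_eigenspace hcomp μ hμ0
    set V := Module.End.eigenspace (S : Module.End ℂ H) μ with hV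
    have hVmem : ∀ x, x ∈ V ↔ S x = μ • x := fun x => Module.End.mem_eigenspace_iff
    have hKV : ∀ x ∈ V, K.toLinearMap x ∈ V := fun x hx => by
      rw [hVmem] at hx ⊢
      change S (K x) = μ • K x
      rw [hcomm, hx, map_smul]
    have : Nontrivial V := Submodule.nontrivial_iff_ne_bot.2 hμ
    obtain ⟨z, hz⟩ := Module.End.exists_eigenvalue (K.toLinearMap.restrict hKV)
    obtain ⟨w, hw⟩ := hz.exists_hasEigenvector
    have hw1 : K (w : H) = z • (w : H) := congrArg Subtype.val hw.apply_eq_smul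
    have hw0 : (w : H) ≠ 0 := fun h => hw.2 (Subtype.ext h)
    have horb : ∀ N, orbitForm K r N w w = 0 := fun N => by
      simp [orbitForm, K.inner_eigenvector_iterate hw1, hr z w hw1]
    have h1 := tendsto_nhds_unique (hS' w w) (by simp only [horb]; exact tendsto_const_nhds)
    rw [(hVmem w).1 w.2, inner_smul_right] at h1
    rcases mul_eq_zero.1 h1 with h | h
    · exact hμ0 h
    · exact hw0 (inner_self_eq_zero.1 h)
  -- At the diagonal point `r` the averaged form is exactly the average to be bounded.
  have h := hre r
  simp only [hzero, orbitForm_self, Complex.ofReal_re] at h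
  simpa using h

end WeakMixing

/-! ### Riesz bounds, frame bounds and Gram matrices. -/

section NearOrthogonal

variable {E ι : Type*} [NormedAddCommGroup E] [InnerProductSpace ℂ E] [Fintype ι] {u : ι → E}

/-- Duality between synthesis and analysis: with `y = ∑ ⟨uⱼ, x⟩ uⱼ`, the sum `S` on the left equals
`⟨y, x⟩`, which is at most `√(B S) ‖x‖`. -/
theorem sum_sq_norm_inner_le_of_norm_sum_le {B : ℝ} (hB : 0 ≤ B)
    (h : ∀ c : ι → ℂ, ‖∑ j, c j • u j‖ ^ 2 ≤ B * ∑ j, ‖c j‖ ^ 2) (x : E) :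
    ∑ j, ‖inner ℂ (u j) x‖ ^ 2 ≤ B * ‖x‖ ^ 2 := by
  set S := ∑ j, ‖inner ℂ (u j) x‖ ^ 2 with hS
  have hS0 : 0 ≤ S := by positivity
  set y := ∑ j, inner ℂ (u j) x • u j with hy
  have h1 : inner ℂ y x = (S : ℂ) := by
    rw [hy, sum_inner, hS]
    push_cast
    refine Finset.sum_congr rfl fun j _ => ?_
    rw [inner_smul_left, Complex.conj_mul']
  have h2 : S ≤ ‖y‖ * ‖x‖ := by
    have := norm_inner_le_norm (𝕜 := ℂ) y x
    rwa [h1, Complex.norm_real, Real.norm_of_nonneg hS0] at this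
  have h3 : S ^ 2 ≤ (B * S) * ‖x‖ ^ 2 := by
    calc S ^ 2 ≤ (‖y‖ * ‖x‖) ^ 2 := pow_le_pow_left₀ hS0 h2 2
      _ = ‖y‖ ^ 2 * ‖x‖ ^ 2 := by ring
      _ ≤ _ := by gcongr; exact h _
  rcases hS0.eq_or_lt with h0 | h0
  · rw [← h0]; positivity
  · refine le_of_mul_le_mul_right ?_ h0
    linarith

/-- Write `x = ∑ cⱼ uⱼ`, apply Cauchy–Schwarz to `⟨x, x⟩ = ∑ c̄ⱼ ⟨uⱼ, x⟩`, and bound the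
coefficients by the hypothesis. Off the span the bound may fail. -/
theorem mul_norm_sq_le_sum_sq_norm_inner {b : ℝ} (hb : 0 < b)
    (h : ∀ c : ι → ℂ, b * ∑ j, ‖c j‖ ^ 2 ≤ ‖∑ j, c j • u j‖ ^ 2) {x : E}
    (hx : x ∈ Submodule.span ℂ (Set.range u)) :
    b * ‖x‖ ^ 2 ≤ ∑ j, ‖inner ℂ (u j) x‖ ^ 2 := by
  obtain ⟨c, hc⟩ := (Submodule.mem_span_range_iff_exists_fun ℂ).1 hx
  set S := ∑ j, ‖inner ℂ (u j) x‖ ^ 2 with hS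
  have h1 : ‖x‖ ^ 2 ≤ ∑ j, ‖c j‖ * ‖inner ℂ (u j) x‖ := by
    have : inner ℂ x x = ∑ j, conj (c j) * inner ℂ (u j) x := by
      conv_lhs => rw [← hc, sum_inner]
      refine Finset.sum_congr rfl fun j _ => ?_
      rw [inner_smul_left, hc]
    have h2 : ‖inner ℂ x x‖ = ‖x‖ ^ 2 := by rw [inner_self_eq_norm_sq_to_K]; simp
    rw [← h2, this]
    refine (norm_sum_le _ _).trans (le_of_eq (Finset.sum_congr rfl fun j _ => ?_))
    rw [norm_mul, RCLike.norm_conj]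
  have h3 : (‖x‖ ^ 2) ^ 2 ≤ (∑ j, ‖c j‖ ^ 2) * S :=
    (pow_le_pow_left₀ (by positivity) h1 2).trans (Finset.sum_mul_sq_le_sq_mul_sq _ _ _)
  have h4 : b * ∑ j, ‖c j‖ ^ 2 ≤ ‖x‖ ^ 2 := hc ▸ h c
  rcases eq_or_ne x 0 with rfl | hx0
  · simp [hS]
  have hxp : 0 < ‖x‖ ^ 2 := by positivity
  have hS0 : 0 ≤ S := by positivity
  refine le_of_mul_le_mul_right ?_ hxp
  calc b * ‖x‖ ^ 2 * ‖x‖ ^ 2 = b * (‖x‖ ^ 2) ^ 2 := by ring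
    _ ≤ b * ((∑ j, ‖c j‖ ^ 2) * S) := by gcongr
    _ = (b * ∑ j, ‖c j‖ ^ 2) * S := by ring
    _ ≤ ‖x‖ ^ 2 * S := by gcongr
    _ = S * ‖x‖ ^ 2 := mul_comm _ _

theorem linearIndependent_of_mul_sum_le {b : ℝ} (hb : 0 < b)
    (h : ∀ c : ι → ℂ, b * ∑ j, ‖c j‖ ^ 2 ≤ ‖∑ j, c j • u j‖ ^ 2) : LinearIndependent ℂ u := by
  rw [Fintype.linearIndependent_iff]
  intro c hc i
  have h1 := h c
  rw [hc] at h1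
  have h2 : ∑ j, ‖c j‖ ^ 2 ≤ 0 := by
    by_contra h0
    have := mul_pos hb (not_le.1 h0)
    simp at h1
    linarith
  have h3 := (Finset.single_le_sum (f := fun j => ‖c j‖ ^ 2) (fun j _ => by positivity)
    (Finset.mem_univ i)).trans h2
  have h4 : ‖c i‖ ^ 2 = 0 := le_antisymm h3 (by positivity)
  simpa using h4

/-- The difference is the form of the Gram matrix minus `t` times the identity, bounded by the sum
of its entries since `‖cⱼ‖ ‖cₗ‖ ≤ ∑ ‖c‖²`. -/
theorem abs_norm_sum_sq_sub_le [DecidableEq ι] (u : ι → E) (t : ℝ) (c : ι → ℂ) :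
    |‖∑ j, c j • u j‖ ^ 2 - t * ∑ j, ‖c j‖ ^ 2|
      ≤ (∑ j, ∑ l, ‖inner ℂ (u j) (u l) - if j = l then (t : ℂ) else 0‖) * ∑ j, ‖c j‖ ^ 2 := by
  set S := ∑ j, ‖c j‖ ^ 2 with hS
  have h1 : ((‖∑ j, c j • u j‖ ^ 2 - t * S : ℝ) : ℂ)
      = ∑ j, ∑ l, conj (c j) * c l * (inner ℂ (u j) (u l) - if j = l then (t : ℂ) else 0) := by
    have e1 : ((‖∑ j, c j • u j‖ ^ 2 : ℝ) : ℂ)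
        = ∑ j, ∑ l, conj (c j) * c l * inner ℂ (u j) (u l) := by
      have : ((‖∑ j, c j • u j‖ ^ 2 : ℝ) : ℂ) = inner ℂ (∑ j, c j • u j) (∑ j, c j • u j) := by
        rw [inner_self_eq_norm_sq_to_K]; simp
      rw [this, sum_inner]
      refine Finset.sum_congr rfl fun j _ => ?_
      rw [inner_sum]
      refine Finset.sum_congr rfl fun l _ => ?_
      rw [inner_smul_left, inner_smul_right]
      ring
    have e2 : ((t * S : ℝ) : ℂ)
        = ∑ j, ∑ l, conj (c j) * c l * (if j = l then (t : ℂ) else 0) := by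
      rw [hS]
      push_cast
      rw [Finset.mul_sum]
      refine Finset.sum_congr rfl fun j _ => ?_
      rw [Finset.sum_eq_single j (fun l _ hl => by simp [hl.symm]) (by simp)]
      rw [Complex.conj_mul']
      simp [mul_comm]
    rw [Complex.ofReal_sub, e1, e2, ← Finset.sum_sub_distrib]
    refine Finset.sum_congr rfl fun j _ => ?_
    rw [← Finset.sum_sub_distrib]
    exact Finset.sum_congr rfl fun l _ => (mul_sub _ _ _).symm
  rw [← Real.norm_eq_abs, ← Complex.norm_real, h1, Finset.sum_mul]
  refine (norm_sum_le _ _).trans (Finset.sum_le_sum fun j _ => ?_)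
  rw [Finset.sum_mul]
  refine (norm_sum_le _ _).trans (Finset.sum_le_sum fun l _ => ?_)
  rw [norm_mul, norm_mul, RCLike.norm_conj, mul_comm]
  gcongr
  have hle : ∀ i, ‖c i‖ ^ 2 ≤ S := fun i =>
    Finset.single_le_sum (f := fun j => ‖c j‖ ^ 2) (fun j _ => by positivity) (Finset.mem_univ i)
  nlinarith [hle j, hle l, sq_nonneg (‖c j‖ - ‖c l‖)]

end NearOrthogonal

/-! ### Asymptotic orthogonality of finite characters. -/

section Characters

/-- The vector `(1, z̄, z̄², …)` of length `n`. -/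
noncomputable def charVec (z : ℂ) (n : ℕ) : EuclideanSpace ℂ (Fin n) :=
  WithLp.toLp 2 fun k => conj z ^ (k : ℕ)

/-- The conjugate in `charVec` serves to make this pairing a polynomial in `z` itself, as needed for
`inner_orbitMap`. -/
theorem inner_charVec (z : ℂ) (n : ℕ) (x : EuclideanSpace ℂ (Fin n)) :
    inner ℂ (charVec z n) x = ∑ k : Fin n, x k * z ^ (k : ℕ) := by
  simp [charVec, PiLp.inner_apply]

theorem inner_charVec_charVec (z w : ℂ) (n : ℕ) :
    inner ℂ (charVec z n) (charVec w n) = ∑ k ∈ Finset.range n, (conj w * z) ^ k := by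
  rw [inner_charVec, Finset.sum_range]
  simp [charVec, mul_pow]

/-- The inner product is a geometric sum with ratio `q = w̄ z ≠ 1` on the unit circle, hence at most
`2 / |q - 1|` for all `n`. -/
theorem tendsto_inner_charVec {z w : ℂ} (hz : ‖z‖ = 1) (hw : ‖w‖ = 1) (hzw : z ≠ w) :
    Tendsto (fun n : ℕ => (n : ℝ)⁻¹ * ‖inner ℂ (charVec z n) (charVec w n)‖) atTop (𝓝 0) := by
  set q := conj w * z with hq
  have hq1 : q ≠ 1 := by
    intro h
    apply hzw
    have hww : w * conj w = 1 := by rw [Complex.mul_conj', hw]; simp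
    calc z = w * conj w * z := by rw [hww, one_mul]
      _ = w * q := by rw [hq, mul_assoc]
      _ = w := by rw [h, mul_one]
  have hqn : ‖q‖ = 1 := by rw [hq, norm_mul, RCLike.norm_conj, hz, hw, one_mul]
  have hb : ∀ n : ℕ, (n : ℝ)⁻¹ * ‖inner ℂ (charVec z n) (charVec w n)‖
      ≤ (n : ℝ)⁻¹ * (2 / ‖q - 1‖) := fun n => by
    rw [inner_charVec_charVec, ← hq, geom_sum_eq hq1, norm_div]
    gcongr
    refine (norm_sub_le _ _).trans ?_
    rw [norm_pow, hqn]
    norm_num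
  refine squeeze_zero (fun n => by positivity) hb ?_
  simpa using (tendsto_inv_atTop_nhds_zero_nat (𝕜 := ℝ)).mul_const (2 / ‖q - 1‖)

theorem inner_charVec_self {z : ℂ} (hz : ‖z‖ = 1) (n : ℕ) :
    inner ℂ (charVec z n) (charVec z n) = (n : ℂ) := by
  rw [inner_charVec_charVec, Complex.conj_mul', hz]
  simp

/-- Characters of the circle at distinct points are asymptotically orthogonal. -/
theorem exists_tendsto_charVec_gram {ι : Type*} [Fintype ι] {z : ι → ℂ} (hz : ∀ j, ‖z j‖ = 1)
    (hinj : Function.Injective z) :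
    ∃ η : ℕ → ℝ, Tendsto η atTop (𝓝 0) ∧ ∀ (n : ℕ) (c : ι → ℂ),
      |‖∑ j, c j • charVec (z j) n‖ ^ 2 - n * ∑ j, ‖c j‖ ^ 2| ≤ n * η n * ∑ j, ‖c j‖ ^ 2 := by
  classical
  refine ⟨fun n => (n : ℝ)⁻¹ * ∑ j, ∑ l, ‖inner ℂ (charVec (z j) n) (charVec (z l) n) -
    if j = l then ((n : ℝ) : ℂ) else 0‖, ?_, fun n c => ?_⟩
  · simp only [Finset.mul_sum]
    rw [show (0 : ℝ) = ∑ j : ι, ∑ l : ι, 0 by simp]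
    refine tendsto_finsetSum _ fun j _ => tendsto_finsetSum _ fun l _ => ?_
    by_cases h : j = l
    · subst h
      simp only [inner_charVec_self (hz j)]
      simp
    · simpa [h] using tendsto_inner_charVec (hz j) (hz l) (hinj.ne h)
  · rcases eq_or_ne n 0 with rfl | hn
    · have : ∀ x : EuclideanSpace ℂ (Fin 0), x = 0 := fun x => Subsingleton.elim _ _
      simp [this]
    · rw [mul_inv_cancel_left₀ (by positivity)]
      exact abs_norm_sum_sq_sub_le (fun j => charVec (z j) n) n c

end Characters

/-! ### Linear combinations of an orbit and their norm bounds. -/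

section OrbitMap

variable {H : Type*} [NormedAddCommGroup H] [InnerProductSpace ℂ H] (K : H →ₗᵢ[ℂ] H)

/-- The map `x ↦ ∑ xₖ Kᵏ g` on `ℂⁿ`. -/
noncomputable def orbitMap (g : H) (n : ℕ) : EuclideanSpace ℂ (Fin n) →ₗ[ℂ] H where
  toFun x := ∑ k : Fin n, x k • K^[k] g
  map_add' x y := by simp [add_smul, Finset.sum_add_distrib]
  map_smul' c x := by simp [mul_smul, Finset.smul_sum]

theorem orbitMap_apply (g : H) (n : ℕ) (x : EuclideanSpace ℂ (Fin n)) :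
    orbitMap K g n x = ∑ k : Fin n, x k • K^[k] g := rfl

theorem orbitMap_add (g h : H) (n : ℕ) (x : EuclideanSpace ℂ (Fin n)) :
    orbitMap K (g + h) n x = orbitMap K g n x + orbitMap K h n x := by
  simp [orbitMap_apply, iterate_map_add, smul_add, Finset.sum_add_distrib]

theorem norm_orbitMap_sq_le (g : H) (n : ℕ) (x : EuclideanSpace ℂ (Fin n)) :
    ‖orbitMap K g n x‖ ^ 2 ≤ n * ‖g‖ ^ 2 * ‖x‖ ^ 2 := by
  have h1 : ‖orbitMap K g n x‖ ≤ ∑ k : Fin n, ‖x k‖ * ‖g‖ := by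
    rw [orbitMap_apply]
    refine (norm_sum_le _ _).trans (le_of_eq (Finset.sum_congr rfl fun k _ => ?_))
    rw [norm_smul, K.norm_iterate]
  calc _ ≤ (∑ k : Fin n, ‖x k‖ * ‖g‖) ^ 2 := pow_le_pow_left₀ (norm_nonneg _) h1 2
    _ ≤ (∑ k : Fin n, ‖x k‖ ^ 2) * ∑ k : Fin n, ‖g‖ ^ 2 := Finset.sum_mul_sq_le_sq_mul_sq _ _ _
    _ = _ := by rw [← EuclideanSpace.norm_sq_eq]; simp; ring

theorem inner_orbitMap {v : H} {z : ℂ} (hv : K v = z • v) (g : H) (n : ℕ)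
    (x : EuclideanSpace ℂ (Fin n)) :
    inner ℂ v (orbitMap K g n x) = inner ℂ v g * inner ℂ (charVec z n) x := by
  rw [orbitMap_apply, inner_sum, inner_charVec, Finset.mul_sum]
  refine Finset.sum_congr rfl fun k _ => ?_
  rw [inner_smul_right, K.inner_eigenvector_iterate hv]
  ring

/-- In each row every distance occurs at most twice, once on each side of the diagonal. -/
theorem sum_sum_dist_le {σ : ℕ → ℝ} (hσ : ∀ k, 0 ≤ σ k) (n : ℕ) :
    ∑ j ∈ Finset.range n, ∑ k ∈ Finset.range n, σ (Nat.dist j k)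
      ≤ n * (2 * ∑ k ∈ Finset.range n, σ k) := by
  refine (Finset.sum_le_card_nsmul _ _ (2 * ∑ k ∈ Finset.range n, σ k) fun j hj => ?_).trans
    (by simp)
  have hj' := Finset.mem_range.1 hj
  rw [← Finset.sum_range_add_sum_Ico _ (show j + 1 ≤ n from hj'), two_mul]
  refine add_le_add ?_ ?_
  · have h1 : ∑ k ∈ Finset.range (j + 1), σ (Nat.dist j k) = ∑ k ∈ Finset.range (j + 1), σ k := by
      rw [← Finset.sum_range_reflect σ]
      refine Finset.sum_congr rfl fun k hk => ?_
      rw [Nat.dist_eq_sub_of_le_right (Nat.lt_succ_iff.1 (Finset.mem_range.1 hk))]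
      congr 1
    rw [h1]
    exact Finset.sum_le_sum_of_subset_of_nonneg (Finset.range_mono hj') fun k _ _ => hσ k
  · rw [Finset.sum_Ico_eq_sum_range]
    have h1 : ∀ k, Nat.dist j (j + 1 + k) = k + 1 := fun k => by
      rw [Nat.dist_eq_sub_of_le (by omega)]; omega
    simp only [h1]
    have h2 := Finset.sum_range_succ' σ (n - (j + 1))
    have h3 := hσ 0
    calc _ ≤ ∑ k ∈ Finset.range (n - (j + 1) + 1), σ k := by rw [h2]; linarith
      _ ≤ _ := Finset.sum_le_sum_of_subset_of_nonneg (Finset.range_mono (by omega))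
        fun k _ _ => hσ k

theorem norm_inner_iterate_iterate (g : H) (j k : ℕ) :
    ‖inner ℂ (K^[j] g) (K^[k] g)‖ = ‖inner ℂ (K^[Nat.dist j k] g) g‖ := by
  rcases le_total j k with h | h
  · obtain ⟨d, rfl⟩ := Nat.exists_eq_add_of_le h
    rw [Nat.dist_eq_sub_of_le h, Nat.add_sub_cancel_left, Function.iterate_add_apply,
      K.inner_iterate_iterate, norm_inner_symm]
  · obtain ⟨d, rfl⟩ := Nat.exists_eq_add_of_le h
    rw [Nat.dist_eq_sub_of_le_right h, Nat.add_sub_cancel_left, Function.iterate_add_apply,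
      K.inner_iterate_iterate]

/-- The Gram matrix of the orbit has entries whose moduli depend only on `|j - k|`. Its
Hilbert–Schmidt norm bounds the form and is at most `√(2 n ∑ σ k)`, which is `n` times the square
root shown. -/
theorem norm_orbitMap_sq_le_sqrt (g : H) (n : ℕ) (x : EuclideanSpace ℂ (Fin n)) :
    ‖orbitMap K g n x‖ ^ 2 ≤
      n * √(2 * ((n : ℝ)⁻¹ * ∑ k ∈ Finset.range n, ‖inner ℂ (K^[k] g) g‖ ^ 2)) * ‖x‖ ^ 2 := by
  rcases eq_or_ne n 0 with rfl | hn
  · simp [orbitMap_apply]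
  set σ : ℕ → ℝ := fun k => ‖inner ℂ (K^[k] g) g‖ ^ 2 with hσ
  have h1 : ‖orbitMap K g n x‖ ^ 2 ≤ ∑ p : Fin n × Fin n, (‖x p.1‖ * ‖x p.2‖) *
      ‖inner ℂ (K^[p.1] g) (K^[p.2] g)‖ := by
    have h2 : ‖inner ℂ (orbitMap K g n x) (orbitMap K g n x)‖ = ‖orbitMap K g n x‖ ^ 2 := by
      rw [inner_self_eq_norm_sq_to_K]; simp
    rw [← h2, orbitMap_apply, sum_inner, Fintype.sum_prod_type]
    refine (norm_sum_le _ _).trans (Finset.sum_le_sum fun j _ => ?_)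
    rw [inner_sum]
    refine (norm_sum_le _ _).trans (Finset.sum_le_sum fun k _ => ?_)
    rw [inner_smul_left, inner_smul_right, norm_mul, norm_mul, RCLike.norm_conj, mul_assoc]
  have h3 : ∑ p : Fin n × Fin n, (‖x p.1‖ * ‖x p.2‖) ^ 2 = (‖x‖ ^ 2) ^ 2 := by
    rw [EuclideanSpace.norm_sq_eq, sq (∑ i, _), Finset.sum_mul_sum, Fintype.sum_prod_type]
    simp only [mul_pow]
  have h4 : ∑ p : Fin n × Fin n, ‖inner ℂ (K^[p.1] g) (K^[p.2] g)‖ ^ 2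
      ≤ n * (2 * ∑ k ∈ Finset.range n, σ k) := by
    refine le_trans (le_of_eq ?_) (sum_sum_dist_le (fun k => by positivity) n)
    rw [Fintype.sum_prod_type, Finset.sum_range]
    refine Finset.sum_congr rfl fun j _ => ?_
    rw [Finset.sum_range]
    refine Finset.sum_congr rfl fun k _ => ?_
    rw [norm_inner_iterate_iterate]
  have h5 : (‖orbitMap K g n x‖ ^ 2) ^ 2
      ≤ (n * √(2 * ((n : ℝ)⁻¹ * ∑ k ∈ Finset.range n, σ k)) * ‖x‖ ^ 2) ^ 2 := by
    calc _ ≤ _ := pow_le_pow_left₀ (by positivity) h1 2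
      _ ≤ _ := Finset.sum_mul_sq_le_sq_mul_sq _ _ _
      _ ≤ (‖x‖ ^ 2) ^ 2 * (n * (2 * ∑ k ∈ Finset.range n, σ k)) := by
        rw [h3]; gcongr
      _ = _ := by
        rw [mul_pow, mul_pow, Real.sq_sqrt (by positivity)]
        field_simp
  exact le_of_sq_le_sq h5 (by positivity)

end OrbitMap

/-! ### Growth of the eigenvalues of the orbit form. -/

section Asymptotics

variable {H : Type*} [NormedAddCommGroup H] [InnerProductSpace ℂ H] (K : H →ₗᵢ[ℂ] H)

theorem LinearIsometry.inner_eigenvectors_eq_zero {v w : H} {z ζ : ℂ} (hv : K v = z • v)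
    (hw : K w = ζ • w) (h : z ≠ ζ) : inner ℂ v w = 0 := by
  have h1 := K.inner_eigenvector_iterate hv 1 w
  rw [Function.iterate_one, hw, inner_smul_right, pow_one] at h1
  by_contra h0
  exact h (mul_right_cancel₀ h0 h1).symm

theorem exists_mem_orthogonal {E : Type*} [NormedAddCommGroup E] [InnerProductSpace ℂ E]
    {V : Submodule ℂ E} {i : ℕ} (hV : finrank ℂ V = i + 1) (w : Fin i → E) :
    ∃ x ∈ V, x ≠ 0 ∧ ∀ j, inner ℂ (w j) x = 0 := by
  have : FiniteDimensional ℂ V := FiniteDimensional.of_finrank_pos (by omega)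
  let L : V →ₗ[ℂ] (Fin i → ℂ) := LinearMap.pi fun j => (innerSL ℂ (w j)).toLinearMap ∘ₗ V.subtype
  have hker : LinearMap.ker L ≠ ⊥ := LinearMap.ker_ne_bot_of_finrank_lt (by simp [hV])
  obtain ⟨x, hx, hx0⟩ := (LinearMap.ker L).exists_mem_ne_zero_of_ne_bot hker
  refine ⟨x, x.2, fun h0 => hx0 (Subtype.ext h0), fun j => ?_⟩
  exact congrFun (LinearMap.mem_ker.1 hx) j

/-- An expansion of `f` in unit eigenvectors of an isometry with distinct eigenvalues, up to a
remainder orthogonal to all eigenvectors, with coefficients of decreasing modulus. -/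
structure EigenExpansion (f : H) (a ξ : ℕ → ℂ) (v : ℕ → H) (r : H) : Prop where
  norm_eq_one : ∀ i, a i ≠ 0 → ‖v i‖ = 1
  eigen : ∀ i, a i ≠ 0 → K (v i) = ξ i • v i
  distinct : ∀ i j, a i ≠ 0 → a j ≠ 0 → i ≠ j → ξ i ≠ ξ j
  remainder_orthogonal : ∀ (z : ℂ) (w : H), K w = z • w → inner ℂ w r = 0
  hasSum : HasSum (fun i => a i • v i) (f - r)
  antitone : Antitone fun i => ‖a i‖

namespace EigenExpansion

variable {K} {f : H} {a ξ : ℕ → ℂ} {v : ℕ → H} {r : H}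

theorem norm_eigenvalue (h : EigenExpansion K f a ξ v r) {i : ℕ} (hi : a i ≠ 0) : ‖ξ i‖ = 1 :=
  K.norm_eigenvalue (norm_ne_zero_iff.1 (by rw [h.norm_eq_one i hi]; simp)) (h.eigen i hi)

theorem orthonormal (h : EigenExpansion K f a ξ v r) {ι : Type*} {s : ι → ℕ}
    (hs : Function.Injective s) (ha : ∀ j, a (s j) ≠ 0) : Orthonormal ℂ fun j => v (s j) :=
  ⟨fun j => h.norm_eq_one _ (ha j), fun j l hjl => K.inner_eigenvectors_eq_zero
    (h.eigen _ (ha j)) (h.eigen _ (ha l)) (h.distinct _ _ (ha j) (ha l) (hs.ne hjl))⟩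

theorem inner_term (h : EigenExpansion K f a ξ v r) {i : ℕ} (hi : a i ≠ 0) (j : ℕ) :
    inner ℂ (v i) (a j • v j) = if j = i then a i else 0 := by
  split_ifs with hji
  · subst hji
    rw [inner_smul_right, inner_self_eq_norm_sq_to_K, h.norm_eq_one _ hi]
    simp
  · rw [inner_smul_right]
    rcases eq_or_ne (a j) 0 with h0 | h0
    · rw [h0, zero_mul]
    · rw [K.inner_eigenvectors_eq_zero (h.eigen i hi) (h.eigen j h0)
        (h.distinct i j hi h0 (Ne.symm hji)), mul_zero]

theorem inner_eq (h : EigenExpansion K f a ξ v r) {i : ℕ} (hi : a i ≠ 0) :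
    inner ℂ (v i) f = a i := by
  have h1 : HasSum (fun j => inner ℂ (v i) (a j • v j)) (inner ℂ (v i) (f - r)) :=
    (innerSL ℂ (v i)).hasSum h.hasSum
  simp only [h.inner_term hi] at h1
  have h2 := h1.unique (hasSum_ite_eq i (a i))
  rwa [inner_sub_right, h.remainder_orthogonal _ _ (h.eigen i hi), sub_zero] at h2

/-- Pythagoras: the orbit of the partial sum stays in the span of the `vⱼ`, `j ∈ J`, while the orbit
of the rest stays orthogonal to them. -/
theorem norm_sq_orbitMap_eq (h : EigenExpansion K f a ξ v r) {J : Finset ℕ}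
    (hJ : ∀ j ∈ J, a j ≠ 0) (n : ℕ) (x : EuclideanSpace ℂ (Fin n)) :
    ‖orbitMap K f n x‖ ^ 2 = ∑ j : J, ‖a j‖ ^ 2 * ‖inner ℂ (charVec (ξ j) n) x‖ ^ 2
      + ‖orbitMap K (f - ∑ j ∈ J, a j • v j) n x‖ ^ 2 := by
  set p := ∑ j ∈ J, a j • v j with hp
  have hon : Orthonormal ℂ fun j : J => v j :=
    h.orthonormal Subtype.val_injective fun j => hJ j j.2
  have hinner : ∀ j ∈ J, inner ℂ (v j) (f - p) = 0 := fun j hj => by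
    rw [inner_sub_right, h.inner_eq (hJ j hj), hp, inner_sum]
    simp [h.inner_term (hJ j hj), hj]
  have hpx : orbitMap K p n x
      = ∑ j : J, (a j * inner ℂ (charVec (ξ j) n) x) • v j := by
    have e : ∀ k, K^[k] p = ∑ j : J, (a j * ξ j ^ k) • v j := fun k => by
      induction k with
      | zero => simpa [hp] using (Finset.sum_attach J fun j => a j • v j).symm
      | succ k ih =>
        rw [Function.iterate_succ_apply', ih, map_sum]
        refine Finset.sum_congr rfl fun j _ => ?_
        rw [map_smul, h.eigen j (hJ j j.2), smul_smul, pow_succ, mul_assoc]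
    simp only [orbitMap_apply, e, inner_charVec, Finset.smul_sum, Finset.mul_sum, Finset.sum_smul]
    rw [Finset.sum_comm]
    refine Finset.sum_congr rfl fun j _ => Finset.sum_congr rfl fun k _ => ?_
    rw [smul_smul]
    congr 1
    ring
  have horth : inner ℂ (orbitMap K p n x) (orbitMap K (f - p) n x) = 0 := by
    rw [hpx, sum_inner]
    refine Finset.sum_eq_zero fun j _ => ?_
    rw [inner_smul_left, inner_orbitMap K (h.eigen j (hJ j j.2)), hinner j j.2, zero_mul, mul_zero]
  have hsplit : orbitMap K f n x = orbitMap K p n x + orbitMap K (f - p) n x := by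
    rw [← orbitMap_add, add_sub_cancel]
  have h1 := norm_add_sq_eq_norm_sq_add_norm_sq_of_inner_eq_zero _ _ horth
  rw [← sq, ← sq, ← sq] at h1
  rw [hsplit, h1]
  congr 1
  have h2 := hon.inner_sum (fun j => a j * inner ℂ (charVec (ξ j) n) x)
    (fun j => a j * inner ℂ (charVec (ξ j) n) x) Finset.univ
  rw [← hpx, inner_self_eq_norm_sq_to_K] at h2
  simp only [Complex.conj_mul', norm_mul] at h2
  simp only [← mul_pow]
  exact Complex.ofReal_injective (by simpa using h2)

/-- The test subspace is the span of the first `i + 1` characters. Bessel's inequality for the `vⱼ`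
bounds the form below by `‖a i‖²` times the sum of squared pairings with these characters, and their
Gram matrix is nearly `n` times the identity. -/
theorem le_maxMin_orbitMap (h : EigenExpansion K f a ξ v r) {i : ℕ} (hi : a i ≠ 0) {ε : ℝ}
    (hε : 0 < ε) (hε1 : ε < 1) :
    ∀ᶠ n : ℕ in atTop, n * (1 - ε) * ‖a i‖ ^ 2 ≤ maxMin (fun x => ‖orbitMap K f n x‖ ^ 2) i := by
  -- Monotonicity of the moduli makes all earlier coefficients nonzero.
  have hne : ∀ j : Fin (i + 1), a j ≠ 0 := fun j => norm_pos_iff.1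
    ((norm_pos_iff.2 hi).trans_le (h.antitone (Nat.lt_succ_iff.1 j.2)))
  obtain ⟨η, hη, hgram⟩ := exists_tendsto_charVec_gram (z := fun j : Fin (i + 1) => ξ j)
    (fun j => h.norm_eigenvalue (hne j)) (fun j l hjl => by
      by_contra hjl'
      exact h.distinct j l (hne j) (hne l) (fun e => hjl' (Fin.ext e)) hjl)
  filter_upwards [hη.eventually_lt_const hε, eventually_gt_atTop 0] with n hn hn0
  have hn0' : (0 : ℝ) < n := by exact_mod_cast hn0
  set b : ℝ := n * (1 - ε) with hb
  have hbpos : 0 < b := mul_pos hn0' (by linarith)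
  have hlow : ∀ c : Fin (i + 1) → ℂ,
      b * ∑ j, ‖c j‖ ^ 2 ≤ ‖∑ j, c j • charVec (ξ j) n‖ ^ 2 := fun c => by
    have h1 := (abs_le.1 (hgram n c)).1
    have h2 : n * η n * ∑ j, ‖c j‖ ^ 2 ≤ n * ε * ∑ j, ‖c j‖ ^ 2 := by gcongr
    rw [hb]
    linarith [mul_sub (n : ℝ) 1 ε, sub_mul (n : ℝ) (n * ε) (∑ j, ‖c j‖ ^ 2),
      congrArg (· * ∑ j, ‖c j‖ ^ 2) (mul_sub (n : ℝ) 1 ε)]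
  refine le_maxMin (fun x => norm_orbitMap_sq_le K f n x)
    (V := Submodule.span ℂ (Set.range fun j : Fin (i + 1) => charVec (ξ j) n)) ?_ fun x hx => ?_
  · rw [finrank_span_eq_card (linearIndependent_of_mul_sum_le hbpos hlow), Fintype.card_fin]
  · have h1 := mul_norm_sq_le_sum_sq_norm_inner hbpos hlow hx
    have hon := h.orthonormal (s := fun j : Fin (i + 1) => (j : ℕ)) Fin.val_injective hne
    have h2 := hon.sum_inner_products_le (orbitMap K f n x) (s := Finset.univ)
    refine le_trans ?_ h2
    calc b * ‖a i‖ ^ 2 * ‖x‖ ^ 2 = ‖a i‖ ^ 2 * (b * ‖x‖ ^ 2) := by ring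
      _ ≤ ‖a i‖ ^ 2 * ∑ j : Fin (i + 1), ‖inner ℂ (charVec (ξ j) n) x‖ ^ 2 := by gcongr
      _ ≤ _ := by
        rw [Finset.mul_sum]
        refine Finset.sum_le_sum fun j _ => ?_
        rw [inner_orbitMap K (h.eigen j (hne j)), h.inner_eq (hne j), norm_mul, mul_pow]
        gcongr
        exact h.antitone (Nat.lt_succ_iff.1 j.2)

/-- Any `(i + 1)`-dimensional subspace has a nonzero vector orthogonal to the first `i` characters.
On it only coefficients of modulus at most `‖a i‖` remain; tail and remainder cost at most `n ε / 2`
each, the latter together with the Gram error. -/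
theorem maxMin_orbitMap_le [CompleteSpace H] (h : EigenExpansion K f a ξ v r) (i : ℕ) {ε : ℝ}
    (hε : 0 < ε) : ∀ᶠ n : ℕ in atTop,
      maxMin (fun x => ‖orbitMap K f n x‖ ^ 2) i ≤ n * (‖a i‖ ^ 2 + ε) := by
  have htail : Tendsto (fun m => 2 * ‖f - r - ∑ j ∈ Finset.range m, a j • v j‖ ^ 2) atTop
      (𝓝 0) := by
    have h1 := ((h.hasSum.tendsto_sum_nat.const_sub (f - r)).norm.pow 2).const_mul 2
    simpa using h1
  obtain ⟨m, hm⟩ := (htail.eventually_lt_const (half_pos hε)).exists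
  -- Indices with `a j = 0` are dropped because `ξ j` and `v j` are arbitrary there.
  set J := (Finset.range m).filter fun j => a j ≠ 0 with hJdef
  have hJ : ∀ j ∈ J, a j ≠ 0 := fun j hj => (Finset.mem_filter.1 hj).2
  have hsum : ∑ j ∈ Finset.range m, a j • v j = ∑ j ∈ J, a j • v j := by
    rw [hJdef, Finset.sum_filter]
    refine Finset.sum_congr rfl fun j _ => ?_
    split_ifs with h0
    · rfl
    · rw [not_not.1 h0, zero_smul]
  rw [hsum] at hm
  set g := f - r - ∑ j ∈ J, a j • v j with hg
  obtain ⟨η, hη, hgram⟩ := exists_tendsto_charVec_gram (z := fun j : J => ξ j)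
    (fun j => h.norm_eigenvalue (hJ j j.2)) (fun j l hjl => by
      by_contra hjl'
      exact h.distinct j l (hJ j j.2) (hJ l l.2) (fun e => hjl' (Subtype.ext e)) hjl)
  have hmix := tendsto_average_sq_norm_inner_iterate K r h.remainder_orthogonal
  set τ : ℕ → ℝ := fun n =>
    √(2 * ((n : ℝ)⁻¹ * ∑ k ∈ Finset.range n, ‖inner ℂ (K^[k] r) r‖ ^ 2)) with hτ
  have hτ0 : Tendsto τ atTop (𝓝 0) := by
    have h1 := (hmix.const_mul 2).sqrt
    rwa [mul_zero, Real.sqrt_zero] at h1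
  have hsmall : Tendsto (fun n => ‖a i‖ ^ 2 * |η n| + 2 * τ n) atTop (𝓝 0) := by
    have h1 := (hη.abs.const_mul (‖a i‖ ^ 2)).add (hτ0.const_mul 2)
    simpa using h1
  filter_upwards [hsmall.eventually_lt_const (half_pos hε)] with n hn
  refine maxMin_le (by positivity) fun c V _ hV hc => ?_
  obtain ⟨x, hxV, hx0, hx⟩ := exists_mem_orthogonal hV fun j : Fin i => charVec (ξ j) n
  have hxp : 0 < ‖x‖ ^ 2 := by positivity
  refine le_of_mul_le_mul_right ((hc x hxV).trans ?_) hxp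
  have hbessel : ∑ j : J, ‖inner ℂ (charVec (ξ j) n) x‖ ^ 2 ≤ n * (1 + |η n|) * ‖x‖ ^ 2 := by
    refine sum_sq_norm_inner_le_of_norm_sum_le (by positivity) (fun c => ?_) x
    have h1 := (abs_le.1 (hgram n c)).2
    have h2 : n * η n * ∑ j, ‖c j‖ ^ 2 ≤ n * |η n| * ∑ j, ‖c j‖ ^ 2 := by
      gcongr
      exact le_abs_self _
    calc _ ≤ n * ∑ j, ‖c j‖ ^ 2 + n * |η n| * ∑ j, ‖c j‖ ^ 2 := by linarith
      _ = _ := by ring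
  have hmain : ∑ j : J, ‖a j‖ ^ 2 * ‖inner ℂ (charVec (ξ j) n) x‖ ^ 2
      ≤ ‖a i‖ ^ 2 * (n * (1 + |η n|) * ‖x‖ ^ 2) := by
    refine le_trans ?_ (mul_le_mul_of_nonneg_left hbessel (by positivity))
    rw [Finset.mul_sum]
    refine Finset.sum_le_sum fun j _ => ?_
    rcases lt_or_ge (j : ℕ) i with hji | hji
    · rw [hx ⟨j, hji⟩]; simp
    · gcongr
      exact h.antitone hji
  have hrest : ‖orbitMap K (f - ∑ j ∈ J, a j • v j) n x‖ ^ 2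
      ≤ 2 * (n * ‖g‖ ^ 2 * ‖x‖ ^ 2) + 2 * (n * τ n * ‖x‖ ^ 2) := by
    -- The crude bound suffices for the small tail `g`; the weakly mixing part `r` needs the
    -- square-root bound.
    have e : f - ∑ j ∈ J, a j • v j = g + r := by rw [hg]; abel
    rw [e, orbitMap_add]
    have h1 := norm_orbitMap_sq_le K g n x
    have h2 := norm_orbitMap_sq_le_sqrt K r n x
    have h3 := pow_le_pow_left₀ (norm_nonneg _)
      (norm_add_le (orbitMap K g n x) (orbitMap K r n x)) 2
    have h4 := add_sq_le (a := ‖orbitMap K g n x‖) (b := ‖orbitMap K r n x‖)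
    linarith
  rw [h.norm_sq_orbitMap_eq hJ]
  calc _ ≤ ‖a i‖ ^ 2 * (n * (1 + |η n|) * ‖x‖ ^ 2)
        + (2 * (n * ‖g‖ ^ 2 * ‖x‖ ^ 2) + 2 * (n * τ n * ‖x‖ ^ 2)) := add_le_add hmain hrest
    _ = n * (‖a i‖ ^ 2 + (2 * ‖g‖ ^ 2 + (‖a i‖ ^ 2 * |η n| + 2 * τ n))) * ‖x‖ ^ 2 := by ring
    _ ≤ n * (‖a i‖ ^ 2 + ε) * ‖x‖ ^ 2 := by
      gcongr
      linarith

theorem tendsto_maxMin_orbitMap [CompleteSpace H] (h : EigenExpansion K f a ξ v r) (i : ℕ) :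
    Tendsto (fun n : ℕ => (n : ℝ)⁻¹ * maxMin (fun x => ‖orbitMap K f n x‖ ^ 2) i) atTop
      (𝓝 (‖a i‖ ^ 2)) := by
  refine tendsto_order.2 ⟨fun t ht => ?_, fun t ht => ?_⟩
  · rcases eq_or_ne (a i) 0 with h0 | h0
    · refine Eventually.of_forall fun n => ?_
      rw [h0] at ht
      refine lt_of_lt_of_le (b := 0) (by simpa using ht) ?_
      exact mul_nonneg (by positivity) (maxMin_nonneg (fun x => by positivity) i)
    · have hp : 0 < ‖a i‖ ^ 2 := by positivity
      obtain ⟨s, hs1, hs2⟩ := exists_between (max_lt ht hp)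
      have hs0 : 0 < s := (le_max_right _ _).trans_lt hs1
      have hts : t < s := (le_max_left _ _).trans_lt hs1
      have hq : s / ‖a i‖ ^ 2 < 1 := (div_lt_one hp).2 hs2
      have hq0 : 0 < s / ‖a i‖ ^ 2 := by positivity
      -- This `ε` makes `(1 - ε) * ‖a i‖ ^ 2 = s`.
      filter_upwards [h.le_maxMin_orbitMap h0 (ε := 1 - s / ‖a i‖ ^ 2) (by linarith)
        (by linarith), eventually_gt_atTop 0] with n hn hn0
      have hn0' : (0 : ℝ) < n := by exact_mod_cast hn0
      refine hts.trans_le ?_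
      rw [← div_eq_inv_mul, le_div_iff₀ hn0']
      refine le_trans (le_of_eq ?_) hn
      field_simp
      ring
  · obtain ⟨s, hs1, hs2⟩ := exists_between ht
    filter_upwards [h.maxMin_orbitMap_le i (sub_pos.2 hs1), eventually_gt_atTop 0] with n hn hn0
    have hn0' : (0 : ℝ) < n := by exact_mod_cast hn0
    refine lt_of_le_of_lt ?_ hs2
    rw [← div_eq_inv_mul, div_le_iff₀ hn0']
    linarith

end EigenExpansion

end Asymptotics

/-! ### Existence of the eigenvector expansion. -/

section Existence

/-- Greedy choice of a maximiser outside the points already taken. A point with `φ z ≠ 0` that is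
never chosen would leave infinitely many values at least `φ z`; infinitude of `α` lets the sequence
go on through the zeros. -/
theorem exists_seq_antitone_of_finite {α : Type*} [Infinite α] {φ : α → ℝ} (h0 : ∀ z, 0 ≤ φ z)
    (hfin : ∀ ε > 0, {z | ε ≤ φ z}.Finite) :
    ∃ s : ℕ → α, Function.Injective s ∧ Antitone (fun n => φ (s n)) ∧
      ∀ z, φ z ≠ 0 → z ∈ Set.range s := by
  classical
  have hmax : ∀ t : Finset α, ∃ z ∉ t, ∀ w ∉ t, φ w ≤ φ z := by
    intro t
    by_cases hpos : ∃ z ∉ t, 0 < φ z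
    · obtain ⟨z₀, hz₀, hφ⟩ := hpos
      obtain ⟨z, ⟨hz, hzt⟩, hzmax⟩ := Set.exists_max_image ({z | φ z₀ ≤ φ z} \ ↑t) φ
        ((hfin _ hφ).subset Set.sdiff_subset) ⟨z₀, le_refl (φ z₀), hz₀⟩
      refine ⟨z, hzt, fun w hw => ?_⟩
      rcases le_total (φ z₀) (φ w) with hle | hle
      · exact hzmax w ⟨hle, hw⟩
      · exact hle.trans hz
    · push Not at hpos
      obtain ⟨z, hz⟩ := Infinite.exists_notMem_finset t
      exact ⟨z, hz, fun w hw => (hpos w hw).trans (h0 z)⟩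
  choose F hF hFmax using hmax
  let T : ℕ → Finset α := fun n => Nat.rec ∅ (fun _ t => insert (F t) t) n
  have hT : ∀ n, T (n + 1) = insert (F (T n)) (T n) := fun n => rfl
  have hmono : Monotone T := monotone_nat_of_le_succ fun n => by
    rw [hT]; exact Finset.subset_insert _ _
  have hmem : ∀ m n, m < n → F (T m) ∈ T n := fun m n hmn =>
    hmono hmn (by rw [hT]; exact Finset.mem_insert_self _ _)
  have hne : ∀ m n, m < n → F (T m) ≠ F (T n) := fun m n hmn h => hF (T n) (h ▸ hmem m n hmn)
  have hinj : Function.Injective fun n => F (T n) := by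
    intro m n h
    rcases lt_trichotomy m n with hmn | hmn | hmn
    · exact absurd h (hne m n hmn)
    · exact hmn
    · exact absurd h.symm (hne n m hmn)
  refine ⟨fun n => F (T n), hinj, fun m n hmn => hFmax (T m) _ fun h => hF (T n) (hmono hmn h),
    fun z hz => ?_⟩
  by_contra hzr
  have hzT : ∀ n, z ∉ T n := fun n => by
    induction n with
    | zero => exact Finset.notMem_empty z
    | succ n ih =>
      rw [hT, Finset.mem_insert, not_or]
      exact ⟨fun h => hzr ⟨n, h.symm⟩, ih⟩
  have hsub : Set.range (fun n => F (T n)) ⊆ {w | φ z ≤ φ w} := by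
    rintro _ ⟨n, rfl⟩
    exact hFmax (T n) z (hzT n)
  exact Set.infinite_range_of_injective hinj
    ((hfin _ (lt_of_le_of_ne (h0 z) (Ne.symm hz))).subset hsub)

variable {H : Type*} [NormedAddCommGroup H] [InnerProductSpace ℂ H] [CompleteSpace H]
  (K : H →ₗᵢ[ℂ] H)

/-- The terms are the projections `p z` of `f` to the mutually orthogonal eigenspaces. By Bessel
their squared norms are summable, so only countably many are nonzero and they can be listed by
decreasing norm. -/
theorem exists_eigenExpansion (f : H) :
    ∃ (a ξ : ℕ → ℂ) (v : ℕ → H) (r : H), EigenExpansion K f a ξ v r := by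
  let V : ℂ → Submodule ℂ H := fun z =>
    LinearMap.ker (K.toContinuousLinearMap - z • ContinuousLinearMap.id ℂ H).toLinearMap
  have hV : ∀ z x, x ∈ V z ↔ K x = z • x := fun z x => by
    simp [V, sub_eq_zero]
  have hcl : ∀ z, IsClosed (V z : Set H) := fun z =>
    (K.toContinuousLinearMap - z • ContinuousLinearMap.id ℂ H).isClosed_ker
  have hcomplete : ∀ z, CompleteSpace (V z) := fun z => (hcl z).completeSpace_coe
  let p : ℂ → H := fun z => (V z).starProjection f
  have hpV : ∀ z, K (p z) = z • p z := fun z => (hV z _).1 ((V z).starProjection_apply_mem f)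
  have hpw : ∀ z w, K w = z • w → inner ℂ w (f - p z) = 0 := fun z w hw =>
    (Submodule.mem_orthogonal _ _).1 ((V z).sub_starProjection_mem_orthogonal f) w ((hV z w).2 hw)
  have hpp : ∀ z, inner ℂ (p z) f = ((‖p z‖ ^ 2 : ℝ) : ℂ) := fun z => by
    have h := hpw z (p z) (hpV z)
    rw [inner_sub_right, inner_self_eq_norm_sq_to_K, sub_eq_zero] at h
    rw [h]; simp
  have hfam : OrthogonalFamily ℂ (fun z => V z) fun z => (V z).subtypeₗᵢ := by
    intro z ζ h x y
    exact K.inner_eigenvectors_eq_zero ((hV z _).1 x.2) ((hV ζ _).1 y.2) h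
  have hbessel : ∀ s : Finset ℂ, ∑ z ∈ s, ‖p z‖ ^ 2 ≤ ‖f‖ ^ 2 := by
    intro s
    set S := ∑ z ∈ s, ‖p z‖ ^ 2 with hS
    have hS0 : 0 ≤ S := by positivity
    have h1 : ‖∑ z ∈ s, p z‖ ^ 2 = S :=
      hfam.norm_sum (fun z => ⟨p z, (V z).starProjection_apply_mem f⟩) s
    have h2 : inner ℂ (∑ z ∈ s, p z) f = (S : ℂ) := by
      rw [sum_inner, hS, Complex.ofReal_sum]
      exact Finset.sum_congr rfl fun z _ => hpp z
    have h3 := norm_inner_le_norm (𝕜 := ℂ) (∑ z ∈ s, p z) f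
    rw [h2, Complex.norm_real, Real.norm_of_nonneg hS0] at h3
    have h4 : S ^ 2 ≤ S * ‖f‖ ^ 2 := by
      calc S ^ 2 ≤ (‖∑ z ∈ s, p z‖ * ‖f‖) ^ 2 := pow_le_pow_left₀ hS0 h3 2
        _ = _ := by rw [mul_pow, h1]
    rcases hS0.eq_or_lt with h0 | h0
    · rw [← h0]; positivity
    · refine le_of_mul_le_mul_left ?_ h0
      linarith
  have hsq : Summable fun z => ‖p z‖ ^ 2 :=
    summable_of_sum_le (fun z => by positivity) hbessel
  have hsum : Summable p :=
    (hfam.summable_iff_norm_sq_summable fun z => ⟨p z, (V z).starProjection_apply_mem f⟩).2 hsq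
  have hfin : ∀ ε > 0, {z | ε ≤ ‖p z‖}.Finite := fun ε hε => by
    have h1 := hsq.tendsto_cofinite_zero.eventually_lt_const (show 0 < ε ^ 2 by positivity)
    refine (Filter.eventually_cofinite.1 h1).subset fun z hz => ?_
    exact not_lt.2 (pow_le_pow_left₀ hε.le hz 2)
  obtain ⟨s, hs, hanti, hrange⟩ := exists_seq_antitone_of_finite (fun z => norm_nonneg (p z)) hfin
  have hne : ∀ i, ((‖p (s i)‖ : ℝ) : ℂ) ≠ 0 → ‖p (s i)‖ ≠ 0 := fun i hi => by exact_mod_cast hi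
  -- Where the projection is zero, the normalised vector is `0` by `0⁻¹ = 0`; the coefficient is
  -- then zero too, so no condition is violated.
  refine ⟨fun i => (‖p (s i)‖ : ℂ), s, fun i => ((‖p (s i)‖ : ℂ))⁻¹ • p (s i), f - ∑' z, p z,
    fun i hi => ?_, fun i _ => ?_, fun i j _ _ hij => hs.ne hij, fun z w hw => ?_, ?_, ?_⟩
  · rw [norm_smul, norm_inv, Complex.norm_real, norm_norm, inv_mul_cancel₀ (hne i hi)]
  · rw [map_smul, hpV, smul_comm]
  -- Against an eigenvector for `z`, only the term `p z` of the sum survives.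
  · have h1 : HasSum (fun ζ => inner ℂ w (p ζ)) (inner ℂ w (∑' z, p z)) :=
      (innerSL ℂ w).hasSum hsum.hasSum
    have h2 : HasSum (fun ζ => inner ℂ w (p ζ)) (inner ℂ w (p z)) :=
      hasSum_single z fun ζ hζ => K.inner_eigenvectors_eq_zero hw (hpV ζ) hζ.symm
    have h3 := hpw z w hw
    rw [inner_sub_right] at h3 ⊢
    rw [h1.unique h2, h3]
  · rw [sub_sub_cancel]
    have h1 : HasSum (p ∘ s) (∑' z, p z) :=
      (hs.hasSum_iff fun z hz => by
        by_contra h0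
        exact hz (hrange z (norm_ne_zero_iff.2 h0))).2 hsum.hasSum
    convert! h1 using 2 with i
    rcases eq_or_ne (p (s i)) 0 with h0 | h0
    · simp [h0]
    · rw [smul_smul, mul_inv_cancel₀ (by simpa using h0), one_smul]; rfl
  · simpa using hanti

end Existence

/-! ### Invariance under complex conjugation. -/

section Conjugation

variable {E : Type*} [NormedAddCommGroup E] [InnerProductSpace ℂ E]

/-- A conjugate-linear isometric bijection preserves norms and the dimension of subspaces, so the
preimage of a test subspace is again one. -/
theorem maxMin_le_maxMin_comp_conj (σ : E ≃ₗᵢ⋆[ℂ] E) {q : E → ℝ} {C : ℝ}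
    (hC : ∀ x, q (σ x) ≤ C * ‖x‖ ^ 2) (h0 : ∀ x, 0 ≤ q x) (i : ℕ) :
    maxMin q i ≤ maxMin (fun x => q (σ x)) i := by
  refine maxMin_le (maxMin_nonneg (fun x => h0 _) i) fun c V _ hV hc => ?_
  let e := σ.symm.toLinearEquiv.submoduleMap V
  refine le_maxMin hC (V := V.map σ.symm.toLinearEquiv.toLinearMap) ?_ ?_
  · rw [← hV, finrank, finrank]
    congr 1
    exact (rank_eq_of_equiv_equiv (starRingEnd ℂ) e.toAddEquiv (starRingAut (R := ℂ)).bijective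
      fun c x => e.map_smulₛₗ c x).symm
  · rintro _ ⟨x, hx, rfl⟩
    have h1 : ‖σ.symm x‖ = ‖x‖ := σ.symm.norm_map x
    change c * ‖σ.symm x‖ ^ 2 ≤ q (σ (σ.symm x))
    rw [h1, σ.apply_symm_apply]
    exact hc x hx

/-- Entrywise complex conjugation. -/
noncomputable def euclideanConj (n : ℕ) :
    EuclideanSpace ℂ (Fin n) ≃ₗᵢ⋆[ℂ] EuclideanSpace ℂ (Fin n) where
  toFun x := WithLp.toLp 2 fun k => conj (x k)
  invFun x := WithLp.toLp 2 fun k => conj (x k)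
  map_add' x y := by ext k; simp
  map_smul' c x := by ext k; simp
  left_inv x := by ext k; simp
  right_inv x := by ext k; simp
  norm_map' x := by simp [EuclideanSpace.norm_eq]

theorem euclideanConj_apply {n : ℕ} (x : EuclideanSpace ℂ (Fin n)) (k : Fin n) :
    euclideanConj n x k = conj (x k) := rfl

theorem euclideanConj_euclideanConj {n : ℕ} (x : EuclideanSpace ℂ (Fin n)) :
    euclideanConj n (euclideanConj n x) = x := by
  ext k; simp [euclideanConj_apply]

theorem maxMin_comp_euclideanConj {n : ℕ} {q : EuclideanSpace ℂ (Fin n) → ℝ} {C : ℝ}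
    (hC : ∀ x, q x ≤ C * ‖x‖ ^ 2) (h0 : ∀ x, 0 ≤ q x) (i : ℕ) :
    maxMin (fun x => q (euclideanConj n x)) i = maxMin q i := by
  have hC' : ∀ x, q (euclideanConj n x) ≤ C * ‖x‖ ^ 2 := fun x => by
    simpa [(euclideanConj n).norm_map] using hC (euclideanConj n x)
  refine le_antisymm ?_ (maxMin_le_maxMin_comp_conj _ hC' h0 i)
  have h := maxMin_le_maxMin_comp_conj (euclideanConj n)
    (q := fun x => q (euclideanConj n x)) (C := C)
    (by simpa only [euclideanConj_euclideanConj] using hC) (fun x => h0 _) i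
  simpa only [euclideanConj_euclideanConj] using h

end Conjugation

/-! ### From trajectory matrices to the orbit form of the time shift. -/

namespace TimeSeries

variable (f : ℕ → ℂ) (hf : AutocovExists f)

theorem norm_koopman (x : HilbertSpace f hf) : ‖koopman f hf x‖ = ‖x‖ := by
  induction x using UniformSpace.Completion.induction_on with
  | hp => exact isClosed_eq (koopman f hf).continuous.norm continuous_norm
  | ih x =>
    have h : koopman f hf (x : HilbertSpace f hf) = (preKoopman f hf x : HilbertSpace f hf) :=
      ContinuousLinearMap.completion_apply_coe _ x
    rw [h, UniformSpace.Completion.norm_coe, UniformSpace.Completion.norm_coe,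
      (preKoopman f hf).norm_map]

/-- The time-shift operator as a linear isometry. -/
noncomputable def koopmanIsometry : HilbertSpace f hf →ₗᵢ[ℂ] HilbertSpace f hf where
  toLinearMap := (koopman f hf).toLinearMap
  norm_map' := norm_koopman f hf

theorem isEigenExpansion_iff {a ξ : ℕ → ℂ} {v : ℕ → HilbertSpace f hf} {r : HilbertSpace f hf} :
    IsEigenExpansion f hf a ξ v r ↔
      EigenExpansion (koopmanIsometry f hf) (observable f hf) a ξ v r :=
  ⟨fun h => ⟨h.1, h.2, h.3, h.4, h.5, h.6⟩, fun h => ⟨h.1, h.2, h.3, h.4, h.5, h.6⟩⟩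

/-- The shifted series `F_l` as an element of the pre-Hilbert space. -/
def shifted (l : ℕ) : PreHilbert f hf := ⟨fun k => f (k + l), Submodule.subset_span ⟨l, rfl⟩⟩

theorem iterate_koopman_observable (l : ℕ) :
    (koopmanIsometry f hf)^[l] (observable f hf) = (shifted f hf l : HilbertSpace f hf) := by
  induction l with
  | zero => rfl
  | succ l ih =>
    rw [Function.iterate_succ_apply', ih]
    have h : koopman f hf (shifted f hf l : HilbertSpace f hf)
        = (preKoopman f hf (shifted f hf l) : HilbertSpace f hf) :=
      ContinuousLinearMap.completion_apply_coe _ _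
    refine h.trans (congrArg _ (Subtype.ext (funext fun k => ?_)))
    exact congrArg f (by omega)

/-- The autocovariance of the series shifted by `k` and by `l`. -/
noncomputable def cov (k l : ℕ) : ℂ := meanInner (fun j => f (j + k)) (fun j => f (j + l))

theorem inner_iterate_koopman (k l : ℕ) :
    inner ℂ ((koopmanIsometry f hf)^[k] (observable f hf))
      ((koopmanIsometry f hf)^[l] (observable f hf)) = cov f k l := by
  rw [iterate_koopman_observable, iterate_koopman_observable, UniformSpace.Completion.inner_coe]
  rfl

/-- There are `M + 1` summands but the divisor is `M`, as in the trajectory matrix; the factor `1 +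
1 / M` makes up for it. -/
theorem tendsto_cov (k l : ℕ) (hf : AutocovExists f) :
    Tendsto (fun M : ℕ => (M : ℂ)⁻¹ *
      ∑ j ∈ Finset.range (M + 1), conj (f (j + k)) * f (j + l)) atTop (𝓝 (cov f k l)) := by
  have h1 := (PreHilbert.tendsto_inner (shifted f hf k) (shifted f hf l)).comp
    (tendsto_add_atTop_nat 1)
  have h2 : Tendsto (fun n : ℕ => 1 + 1 / (n : ℂ)) atTop (𝓝 (1 + 0)) :=
    tendsto_const_nhds.add tendsto_one_div_atTop_nhds_zero_nat
  have h3 := h2.mul h1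
  rw [add_zero, one_mul] at h3
  refine h3.congr' ?_
  filter_upwards [eventually_ge_atTop 1] with n hn
  have hn0 : (n : ℂ) ≠ 0 := by exact_mod_cast (by omega : n ≠ 0)
  have hn1 : (n : ℂ) + 1 ≠ 0 := by exact_mod_cast (by omega : n + 1 ≠ 0)
  have e : timeAvg (shifted f hf k).val (shifted f hf l).val (n + 1)
      = 1 / ((n + 1 : ℕ) : ℂ) * ∑ j ∈ Finset.range (n + 1), conj (f (j + k)) * f (j + l) := rfl
  rw [Function.comp_apply, e]
  push_cast
  field_simp

theorem norm_sq_sum_mul_eq {n : ℕ} (x : Fin n → ℂ) (b : Fin n → ℂ) :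
    ((‖∑ k, x k * b k‖ ^ 2 : ℝ) : ℂ) = ∑ k, ∑ l, conj (x k) * x l * (conj (b k) * b l) := by
  push_cast
  rw [← Complex.conj_mul', map_sum, Finset.sum_mul_sum]
  refine Finset.sum_congr rfl fun k _ => Finset.sum_congr rfl fun l _ => ?_
  rw [map_mul]
  ring

theorem norm_sq_orbitMap_koopman {n : ℕ} (x : EuclideanSpace ℂ (Fin n)) :
    ((‖orbitMap (koopmanIsometry f hf) (observable f hf) n x‖ ^ 2 : ℝ) : ℂ)
      = ∑ k, ∑ l, conj (x k) * x l * cov f k l := by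
  have h : ((‖orbitMap (koopmanIsometry f hf) (observable f hf) n x‖ ^ 2 : ℝ) : ℂ)
      = inner ℂ (orbitMap (koopmanIsometry f hf) (observable f hf) n x)
        (orbitMap (koopmanIsometry f hf) (observable f hf) n x) := by
    rw [inner_self_eq_norm_sq_to_K]; simp
  rw [h, orbitMap_apply, sum_inner]
  refine Finset.sum_congr rfl fun k _ => ?_
  rw [inner_sum]
  refine Finset.sum_congr rfl fun l _ => ?_
  rw [inner_smul_left, inner_smul_right, inner_iterate_koopman, mul_assoc]

/-- Conjugating `x` undoes the conjugates in the adjoint matrix, which leaves a form with the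
sesquilinear pattern of `cov`. -/
theorem norm_sq_adjoint_trajectory (N M : ℕ) (x : EuclideanSpace ℂ (Fin (N + 1))) :
    ‖LinearMap.adjoint (Matrix.toEuclideanLin (trajectoryMatrix f N M)) (euclideanConj _ x)‖ ^ 2
      = ∑ j ∈ Finset.range (M + 1), ‖∑ k, x k * f (j + k)‖ ^ 2 := by
  rw [← Matrix.toEuclideanLin_conjTranspose_eq_adjoint, EuclideanSpace.norm_sq_eq,
    Finset.sum_range]
  refine Finset.sum_congr rfl fun j _ => ?_
  rw [← RCLike.norm_conj]
  congr 2
  simp [Matrix.toLpLin_apply, Matrix.mulVec, dotProduct, trajectoryMatrix,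
    euclideanConj_apply, mul_comm, add_comm]

/-- On the fixed space `ℂ^(N+1)`, entrywise convergence to the covariance matrix gives uniform
convergence of the forms, with the sum `δ` of the entry errors as rate. -/
theorem tendsto_sq_trajectorySingularValue (N i : ℕ) :
    Tendsto (fun M : ℕ => (M : ℝ)⁻¹ * trajectorySingularValue f N M i ^ 2) atTop
      (𝓝 (maxMin (fun x =>
        ‖orbitMap (koopmanIsometry f hf) (observable f hf) (N + 1) x‖ ^ 2) i)) := by
  set T := fun M => LinearMap.adjoint (Matrix.toEuclideanLin (trajectoryMatrix f N M)) with hT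
  set δ : ℕ → ℝ := fun M => ∑ k : Fin (N + 1), ∑ l : Fin (N + 1), ‖(M : ℂ)⁻¹ *
      ∑ j ∈ Finset.range (M + 1), conj (f (j + k)) * f (j + l) - cov f k l‖ with hδ
  have hδ0 : Tendsto δ atTop (𝓝 0) := by
    rw [show (0 : ℝ) = ∑ k : Fin (N + 1), ∑ l : Fin (N + 1), 0 by simp]
    refine tendsto_finsetSum _ fun k _ => tendsto_finsetSum _ fun l _ => ?_
    exact tendsto_iff_norm_sub_tendsto_zero.1 (tendsto_cov f k l hf)
  have hlim := tendsto_maxMin (q := fun M x => (M : ℝ)⁻¹ * ‖T M (euclideanConj _ x)‖ ^ 2)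
    (q₀ := fun x => ‖orbitMap (koopmanIsometry f hf) (observable f hf) (N + 1) x‖ ^ 2)
    (ε := δ) (fun M x => by positivity) (fun x => by positivity)
    (fun x => norm_orbitMap_sq_le _ _ _ x) hδ0 (Eventually.of_forall fun M x => ?_) i
  · refine hlim.congr' ?_
    filter_upwards [eventually_gt_atTop 0] with M hM
    have hM' : (0 : ℝ) < (M : ℝ)⁻¹ := by positivity
    obtain ⟨C, hC⟩ := (T M).exists_norm_sq_le
    rw [maxMin_const_mul (q := fun x => ‖T M (euclideanConj _ x)‖ ^ 2) (C := C)
      (fun x => by simpa [(euclideanConj _).norm_map] using hC (euclideanConj _ x))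
      (fun x => by positivity) hM' i,
      maxMin_comp_euclideanConj (q := fun x => ‖T M x‖ ^ 2) hC (fun x => by positivity) i,
      trajectorySingularValue, sq_singularValues_eq_maxMin_adjoint]
  · rw [hT]
    simp only [norm_sq_adjoint_trajectory]
    rw [← Real.norm_eq_abs, ← Complex.norm_real, Complex.ofReal_sub, norm_sq_orbitMap_koopman]
    have e : (((M : ℝ)⁻¹ * ∑ j ∈ Finset.range (M + 1), ‖∑ k, x k * f (j + k)‖ ^ 2 : ℝ) : ℂ)
        = ∑ k, ∑ l, conj (x k) * x l *
          ((M : ℂ)⁻¹ * ∑ j ∈ Finset.range (M + 1), conj (f (j + k)) * f (j + l)) := by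
      rw [Complex.ofReal_mul, Complex.ofReal_sum]
      simp only [norm_sq_sum_mul_eq, Complex.ofReal_inv, Complex.ofReal_natCast]
      simp only [Finset.mul_sum]
      rw [Finset.sum_comm]
      refine Finset.sum_congr rfl fun k _ => ?_
      rw [Finset.sum_comm]
      refine Finset.sum_congr rfl fun l _ => Finset.sum_congr rfl fun j _ => ?_
      ring
    rw [e, ← Finset.sum_sub_distrib, hδ, Finset.sum_mul]
    refine (norm_sum_le _ _).trans (Finset.sum_le_sum fun k _ => ?_)
    rw [← Finset.sum_sub_distrib, Finset.sum_mul]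
    refine (norm_sum_le _ _).trans (Finset.sum_le_sum fun l _ => ?_)
    rw [← mul_sub, norm_mul, norm_mul, RCLike.norm_conj, mul_comm, sq]
    gcongr <;> exact PiLp.norm_apply_le x _

end TimeSeries

theorem mainTheorem3 (f : ℕ → ℂ) (hf : TimeSeries.AutocovExists f) :
    (∃ (a ξ : ℕ → ℂ) (v : ℕ → TimeSeries.HilbertSpace f hf) (r : TimeSeries.HilbertSpace f hf),
      TimeSeries.IsEigenExpansion f hf a ξ v r) ∧
    ∀ (a ξ : ℕ → ℂ) (v : ℕ → TimeSeries.HilbertSpace f hf) (r : TimeSeries.HilbertSpace f hf),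
      TimeSeries.IsEigenExpansion f hf a ξ v r →
      ∀ i : ℕ, ∃ L : ℕ → ℝ,
        (∀ N : ℕ, Filter.Tendsto
          (fun M : ℕ => TimeSeries.trajectorySingularValue f N M i ^ 2 / ((N : ℝ) * (M : ℝ)))
          Filter.atTop (nhds (L N))) ∧
        Filter.Tendsto L Filter.atTop (nhds (‖a i‖ ^ 2)) := by
  refine ⟨?_, fun a ξ v r h i => ?_⟩
  · obtain ⟨a, ξ, v, r, h⟩ :=
      exists_eigenExpansion (TimeSeries.koopmanIsometry f hf) (TimeSeries.observable f hf)
    exact ⟨a, ξ, v, r, (TimeSeries.isEigenExpansion_iff f hf).2 h⟩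
  · set μ : ℕ → ℝ := fun n => maxMin (fun x => ‖orbitMap (TimeSeries.koopmanIsometry f hf)
      (TimeSeries.observable f hf) n x‖ ^ 2) i with hμ
    -- The matrix has `N + 1` rows while the divisor is `N`. At `N = 0` both sides are zero, since
    -- `0⁻¹ = 0`; in the outer limit the mismatch is a factor `1 + 1 / N`.
    refine ⟨fun N => (N : ℝ)⁻¹ * μ (N + 1), fun N => ?_, ?_⟩
    · refine ((TimeSeries.tendsto_sq_trajectorySingularValue f hf N i).const_mul
        (N : ℝ)⁻¹).congr fun M => ?_
      rw [div_eq_inv_mul, mul_inv, mul_assoc]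
    · have h1 := (((TimeSeries.isEigenExpansion_iff f hf).1 h).tendsto_maxMin_orbitMap i).comp
        (tendsto_add_atTop_nat 1)
      have h2 : Tendsto (fun n : ℕ => 1 + 1 / (n : ℝ)) atTop (𝓝 (1 + 0)) :=
        tendsto_const_nhds.add tendsto_one_div_atTop_nhds_zero_nat
      have h3 := h2.mul h1
      rw [add_zero, one_mul] at h3
      refine h3.congr' ?_
      filter_upwards [eventually_ge_atTop 1] with n hn
      have hn0 : (n : ℝ) ≠ 0 := by positivity
      simp only [Function.comp_apply, hμ]
      push_cast
      field_simp
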